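/- **Setting.** On a probability space consider the reserve $$U_t(u)=u+ct-\sum_{i=1}^{N_t}Z_i,\qquad u,t\ge 0,$$ where $c>0$, $(N_t)$ is a Poisson process of intensity $\lambda>0$, and $(Z_i)_{i\ge1}$ are i.i.d. positive random variables, independent of $(N_t)$, with distribution function $F$ of unbounded support. Put $$m_j=\mathbb E[Z_1^j],\quad f_I=\frac{1-F}{m_1},\quad F_I(x)=\int_0^x f_I(y)\,dy,\quad \theta=\frac{c}{\lambda m_1}-1,$$ $$T(u)=\inf\{t\ge0: U_t(u)<0\},\qquad \psi(u)=\mathbb P(T(u)<\infty).$$ For $k\ge2$ the assumptions are: * (A1) there is $R>0$ with $\int_0^\infty e^{Rx}\frac{f_I(x)}{1+\theta}\,dx=1$; * (A2) $m_k^{\exp}:=\int_0^\infty x^k e^{Rx}\frac{f_I(x)}{1+\theta}\,dx<\infty$; * (A3) $h_I:=\sup_{x\ge0}\frac{f_I(x)}{1-F_I(x)}<\infty$. Let $(U^{DV}_t)$ be a second model of the same kind (its quantities carry the superscript $DV$). It is a *De Vylder type approximation of order $k$* of $(U_t)$ if $\mathbb E[U_t(u)^j]=\mathbb E[U^{DV}_t(u)^j]$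 for all $j=1,\dots,k$ and all $t,u\ge0$. **Theorem.** Let $k\ge2$, and let real numbers $\mu_1,\dots,\mu_k$, $\mu^{DV}_1,\dots,\mu^{DV}_k$, $K$, $H$, $\Theta$ be given. There is a constant $C\ge0$, depending only on $k$ and these numbers, such that the following holds for all models $(U_t)$ and $(U_t^{DV})$ that both satisfy (A1), (A2), (A3), such that $(U_t^{DV})$ is a De Vylder type approximation of order $k$ of $(U_t)$, and such that $m_j=\mu_j$ and $m^{DV}_j=\mu^{DV}_j$ for $1\le j\le k$, $m_k^{\exp},m_k^{\exp,DV}\le K$, $h_I,h_I^{DV}\le H$ and $0<\theta\le\Theta$. 1. For all $u\ge0$, $$|\psi(u)-\psi^{DV}(u)|\le C(\theta+\theta^k u)\exp\bigl(-\min(R,R^{DV})\,u\bigr).$$ 2. There is a real $r$, independent of $u$, with $|r|\le C\theta^2$ and, for all $u\ge0$, $$|\psi(u)-\psi^{DV}(u)|\le C(\theta+\theta^k u)\exp\Bigl(-\Bigl|\frac{2m_1}{m_2}\theta+r\Bigr|u\Bigr).$$ 3. For all $u\ge0$, $\psi(u)>0$ and $$\left|\frac{\psi(u)-\psi^{DV}(u)}{\psi(u)}\right|\le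 C(\theta+\theta^k u)\exp\bigl(C\,\theta^k u\,\mathbf 1_{R>R^{DV}}\bigr).$$ -/

import Mathlib

open MeasureTheory ProbabilityTheory Set
open scoped ENNReal NNReal

noncomputable section

/-- The driving randomness and the parameters of the classical compound Poisson risk model on a
probability space `(Ω, P)`. The Poisson process of intensity `lam` is given by its i.i.d.
exponential inter-arrival times `W 0, W 1, …`; the claims `Z 0, Z 1, …` are i.i.d., positive, of
unbounded support, and independent of the arrivals. Indices start at `0` instead of `1`. -/
structure RiskModel (Ω : Type*) [MeasurableSpace Ω] (P : Measure Ω) where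
  /-- intensity of the claim arrivals -/
  lam : ℝ
  /-- premium per unit time -/
  c : ℝ
  /-- inter-arrival times -/
  W : ℕ → Ω → ℝ
  /-- claim costs -/
  Z : ℕ → Ω → ℝ
  lam_pos : 0 < lam
  c_pos : 0 < c
  measurable_W : ∀ i, Measurable (W i)
  measurable_Z : ∀ i, Measurable (Z i)
  law_W : ∀ i, P.map (W i) = expMeasure lam
  ident_Z : ∀ i, P.map (Z i) = P.map (Z 0)
  pos_Z : ∀ i, ∀ᵐ ω ∂P, 0 < Z i ω
  unbounded_Z : ∀ x : ℝ, 0 < P {ω | x < Z 0 ω}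
  indep : iIndepFun (Sum.elim W Z : ℕ ⊕ ℕ → Ω → ℝ) P

namespace RiskModel

variable {Ω : Type*} [MeasurableSpace Ω] {P : Measure Ω}

/-- `n`-th arrival time (`arrival 0 = 0` is not the time of a claim). -/
def arrival (X : RiskModel Ω P) (n : ℕ) (ω : Ω) : ℝ := ∑ i ∈ Finset.range n, X.W i ω

/-- The Poisson process `N_t`: the number of claims until time `t` (almost surely finite). -/
def count (X : RiskModel Ω P) (t : ℝ) (ω : Ω) : ℕ := {n : ℕ | X.arrival (n + 1) ω ≤ t}.ncard

/-- The reserve `U_t(u) = u + c t - ∑_{i = 1}^{N_t} Z_i`. -/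
def reserve (X : RiskModel Ω P) (u t : ℝ) (ω : Ω) : ℝ :=
  u + X.c * t - ∑ i ∈ Finset.range (X.count t ω), X.Z i ω

/-- The time of ruin `T(u) = inf {t ≥ 0 : U_t(u) < 0}`, with values in `[0, ∞]`. -/
def ruinTime (X : RiskModel Ω P) (u : ℝ) (ω : Ω) : ℝ≥0∞ :=
  ⨅ (t : ℝ≥0) (_ : X.reserve u t ω < 0), (t : ℝ≥0∞)

/-- The ruin probability `ψ(u) = P(T(u) < ∞)`. -/
def ruinProb (X : RiskModel Ω P) (u : ℝ) : ℝ := P.real {ω | X.ruinTime u ω < ∞}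

/-- The claim moment `m_j = E[Z_1 ^ j]`. -/
def moment (X : RiskModel Ω P) (j : ℕ) : ℝ := ∫ ω, X.Z 0 ω ^ j ∂P

/-- The claim distribution function `F`. -/
def F (X : RiskModel Ω P) (x : ℝ) : ℝ := P.real {ω | X.Z 0 ω ≤ x}

/-- The integrated tail density `f_I = (1 - F) / m₁`. -/
def fI (X : RiskModel Ω P) (x : ℝ) : ℝ := (1 - X.F x) / X.moment 1

/-- The integrated tail distribution function `F_I(x) = (1 / m₁) ∫₀ˣ (1 - F(y)) dy`. -/
def FI (X : RiskModel Ω P) (x : ℝ) : ℝ := (1 / X.moment 1) * ∫ y in (0 : ℝ)..x, (1 - X.F y)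

/-- The safety loading `θ = c / (λ m₁) - 1`. -/
def theta (X : RiskModel Ω P) : ℝ := X.c / (X.lam * X.moment 1) - 1

/-- The Cramér–Lundberg condition: `R > 0` is the adjustment coefficient. -/
def IsAdjustmentCoeff (X : RiskModel Ω P) (R : ℝ) : Prop :=
  0 < R ∧
  IntegrableOn (fun x : ℝ => Real.exp (R * x) * (X.fI x / (1 + X.theta))) (Ioi 0) ∧
  ∫ x in Ioi (0 : ℝ), Real.exp (R * x) * (X.fI x / (1 + X.theta)) = 1

/-- `m_k^exp < ∞`, for the adjustment coefficient `R`. -/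
def HasExpMoment (X : RiskModel Ω P) (k : ℕ) (R : ℝ) : Prop :=
  IntegrableOn (fun x : ℝ => x ^ k * Real.exp (R * x) * (X.fI x / (1 + X.theta))) (Ioi 0)

/-- `m_k^exp = ∫₀^∞ x ^ k exp(R x) f_I(x) / (1 + θ) dx`. -/
def expMoment (X : RiskModel Ω P) (k : ℕ) (R : ℝ) : ℝ :=
  ∫ x in Ioi (0 : ℝ), x ^ k * Real.exp (R * x) * (X.fI x / (1 + X.theta))

/-- The set of values on `[0, ∞)` of the hazard rate `f_I / (1 - F_I)` of the integrated tail. -/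
def hazardSet (X : RiskModel Ω P) : Set ℝ := (fun x : ℝ => X.fI x / (1 - X.FI x)) '' Ici 0

/-- `h_I = sup_{x ≥ 0} f_I(x) / (1 - F_I(x))`. -/
def hI (X : RiskModel Ω P) : ℝ := sSup X.hazardSet

/-- The three standing assumptions: Cramér–Lundberg condition with adjustment coefficient `R`,
finite `m_k^exp`, and bounded hazard rate of the integrated tail. -/
def Assumptions (X : RiskModel Ω P) (k : ℕ) (R : ℝ) : Prop :=
  X.IsAdjustmentCoeff R ∧ X.HasExpMoment k R ∧ BddAbove X.hazardSet

/-- `Y` is a De Vylder type approximation of order `k` of `X`: the first `k` moments of the two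
reserve processes agree, at all times and for all initial reserves. -/
def IsDeVylder {Ω' : Type*} [MeasurableSpace Ω'] {P' : Measure Ω'}
    (X : RiskModel Ω P) (Y : RiskModel Ω' P') (k : ℕ) : Prop :=
  ∀ j : ℕ, 1 ≤ j → j ≤ k → ∀ t u : ℝ, 0 ≤ t → 0 ≤ u →
    ∫ ω, X.reserve u t ω ^ j ∂P = ∫ ω, Y.reserve u t ω ^ j ∂P'

end RiskModel

end

/-! Write `ρ = f_I / (1 + θ)`. Conditioning on the first claim gives the renewal equation `ψ(u) =
∫₀^∞ ψ(u - y) ρ(y) dy` for `u ≥ 0`, with `ψ = 1` on the negative half-line (`survival_renewal`,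
`survival_zero_add`). By the choice of `R`, the density `e^{Ry} ρ(y)` has mass one, and `V(u) =
e^{Ru} ψ(u)` is its own average along the random walk with these steps. So is every affine function
`a - C V`.

The analytic core is `renewal_bound`: a nonnegative function on the line that is dominated by its
average along the walk for `u ≥ 0`, and by `A |v|` for `v < 0`, is at most `A` times a constant
built from the first two step moments and the hazard rate. Applied to positive parts of affine
functions of `V`, it yields `V ≤ 1`, `1 - V ≤ R (1 + K)(1 + H)`, and a positive lower bound for `V`
that holds even when `R` is not small. Since `R = O(θ)`, this means `ψ(u) = e^{-Ru} (1 + O(θ))`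
uniformly in `u`.

It remains to compare `R` with `R^{DV}`. The right derivative at `t = 0` of the reserve moments
shows that the two models share `c - λ m₁` and `λ m_j` for `2 ≤ j ≤ k` (`IsDeVylder.cumulants`).
Expanding the exponential in the equation for `R` up to order `k` gives a polynomial equation with
these common coefficients and an error `O(R^k)`. The polynomial grows at least linearly, so `R -
R^{DV} = O(θ^k)`; the expansion to order two gives `R = (2 m₁ / m₂) θ + O(θ²)`. The three claims
follow from `|e^{-Ru} - e^{-R'u}| ≤ e^{-min(R, R') u} |R - R'| u`. -/

/-! ### Renewal inequalities for steps with bounded hazard rate. -/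

/-- Integrating a convolution over a half-line. -/
theorem setLIntegral_Iic_conv {E g : ℝ → ℝ≥0∞} (hE : Measurable E) (hg : Measurable g) (u : ℝ) :
    ∫⁻ v in Iic u, ∫⁻ y, E (v - y) * g y = ∫⁻ y, (∫⁻ v in Iic (u - y), E v) * g y := by
  rw [lintegral_lintegral_swap (by fun_prop)]
  refine lintegral_congr fun y => ?_
  rw [lintegral_mul_const _ (by fun_prop)]
  congr 1
  rw [← lintegral_indicator measurableSet_Iic, ← lintegral_indicator measurableSet_Iic,
    ← lintegral_sub_right_eq_self ((Iic (u - y)).indicator E) y]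
  refine lintegral_congr fun v => ?_
  simp only [indicator, mem_Iic, sub_le_sub_iff_right]

/-- A bounded-mean-excess form of the renewal inequality: integrating a subsolution of a renewal
equation against the tail of the step distribution. -/
theorem lintegral_mul_tail_le {E e g : ℝ → ℝ≥0∞} (hE : Measurable E) (he : Measurable e)
    (hg : Measurable g) (hg1 : ∫⁻ y, g y = 1) (u : ℝ)
    (hrec : ∀ v ≤ u, E v ≤ e v + ∫⁻ y, E (v - y) * g y)
    (hfin : ∫⁻ v in Iic u, E v ≠ ∞) (hg0 : ∀ y < 0, g y = 0) :
    ∫⁻ v in Iic u, E v * ∫⁻ y in Ioi (u - v), g y ≤ ∫⁻ v in Iic u, e v := by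
  set I : ℝ → ℝ≥0∞ := fun w => ∫⁻ v in Iic w, E v with hI
  have hImono : Monotone I := fun a b hab => lintegral_mono_set (Iic_subset_Iic.2 hab)
  have h1 : I u ≤ (∫⁻ v in Iic u, e v) + ∫⁻ y, I (u - y) * g y := by
    calc I u ≤ ∫⁻ v in Iic u, (e v + ∫⁻ y, E (v - y) * g y) :=
          setLIntegral_mono' measurableSet_Iic hrec
      _ = _ := by rw [lintegral_add_left he, setLIntegral_Iic_conv hE hg]
  -- Because `g` has mass one, `I u` is an average of itself; each copy is split at `u - y`, so that
  -- the shifted part can be cancelled against `h1`.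
  have h2 : I u = (∫⁻ y, (∫⁻ v in Ioc (u - y) u, E v) * g y) + ∫⁻ y, I (u - y) * g y := by
    have : Measurable fun y => I (u - y) := hImono.measurable.comp (by fun_prop)
    have hm : Measurable fun y => I (u - y) * g y := this.mul hg
    rw [← lintegral_add_right _ hm]
    calc I u = ∫⁻ y, I u * g y := by rw [lintegral_const_mul _ hg, hg1, mul_one]
      _ = _ := by
        refine lintegral_congr fun y => ?_
        rcases lt_or_ge y 0 with hy | hy
        · simp [hg0 y hy]
        · rw [← add_mul, add_comm, hI]
          simp only
          rw [← lintegral_union measurableSet_Ioc (Iic_disjoint_Ioc le_rfl),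
            Iic_union_Ioc_eq_Iic (by linarith)]
  have h3 : ∫⁻ y, I (u - y) * g y ≠ ∞ := by
    refine ne_top_of_le_ne_top hfin ?_
    change _ ≤ I u
    rw [h2]; exact le_add_self
  have h4 : (∫⁻ y, (∫⁻ v in Ioc (u - y) u, E v) * g y) ≤ ∫⁻ v in Iic u, e v := by
    rw [h2] at h1
    exact (ENNReal.add_le_add_iff_right h3).1 h1
  refine le_trans (le_of_eq ?_) h4
  have h5 : ∀ y, (∫⁻ v in Ioc (u - y) u, E v) * g y
      = ∫⁻ v in Iic u, E v * (Ioi (u - v)).indicator g y := by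
    intro y
    rw [← lintegral_mul_const _ hE, ← lintegral_indicator measurableSet_Ioc,
      ← lintegral_indicator measurableSet_Iic]
    refine lintegral_congr fun v => ?_
    simp only [indicator, mem_Ioc, mem_Iic, mem_Ioi]
    by_cases h : v ≤ u <;> by_cases h' : u - v < y
    · have : u - y < v := by linarith
      simp [h, h', this]
    · have : ¬ (u - y < v) := by intro; apply h'; linarith
      simp [h, h', this]
    · simp [h]
    · simp [h]
  simp_rw [h5]
  rw [lintegral_lintegral_swap]
  · refine lintegral_congr fun v => ?_
    rw [lintegral_const_mul _ (hg.indicator measurableSet_Ioi), lintegral_indicator measurableSet_Ioi]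
  · have : Measurable (fun p : ℝ × ℝ => {q : ℝ × ℝ | u - q.2 < q.1}.indicator (fun q => g q.1) p) :=
      (hg.comp measurable_fst).indicator (measurableSet_lt (by fun_prop) (by fun_prop))
    exact ((hE.comp measurable_snd).mul this).aemeasurable

/-- A function dominated by its own average along a random walk with step density `g` of bounded
hazard rate, and growing at most linearly on the negative half-line, is bounded. -/
theorem renewal_bound {E g : ℝ → ℝ≥0∞} (hE : Measurable E) (hg : Measurable g)
    {A h M₁ M₂ : ℝ≥0∞} (hh : h ≠ ∞)
    (hg1 : ∫⁻ y in Ioi 0, g y = 1)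
    (hgh : ∀ y, 0 ≤ y → g y ≤ h * ∫⁻ z in Ioi y, g z)
    (hM₁ : ∫⁻ y in Ioi 0, ENNReal.ofReal y * g y ≤ M₁)
    (hM₂ : ∫⁻ y in Ioi 0, ENNReal.ofReal y * (ENNReal.ofReal y * g y) ≤ M₂)
    (hrec : ∀ u, 0 ≤ u → E u ≤ ∫⁻ y in Ioi 0, E (u - y) * g y)
    (hneg : ∀ v < 0, E v ≤ A * ENNReal.ofReal (-v))
    (hfin : ∀ u, ∫⁻ x in Icc 0 u, E x ≠ ∞) (u : ℝ) (hu : 0 ≤ u) :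
    E u ≤ A * (M₁ + h * M₂) := by
  set E' : ℝ → ℝ≥0∞ := (Ici 0).indicator E with hE'
  set g' : ℝ → ℝ≥0∞ := (Ioi 0).indicator g with hg'
  -- Steps `y > v` land on the negative half-line, where `E (v - y) ≤ A (y - v) ≤ A y`; they
  -- contribute at most `A * N v`, the forcing term `e` of a renewal inequality for `E'`.
  set N : ℝ → ℝ≥0∞ := fun v => ∫⁻ y in Ioi v, ENNReal.ofReal y * g' y with hN
  set e : ℝ → ℝ≥0∞ := (Ici 0).indicator (fun v => A * N v) with he
  have hE'm : Measurable E' := hE.indicator measurableSet_Ici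
  have hg'm : Measurable g' := hg.indicator measurableSet_Ioi
  have hNanti : Antitone N := fun a b hab => lintegral_mono_set (Ioi_subset_Ioi hab)
  have hem : Measurable e := (hNanti.measurable.const_mul A).indicator measurableSet_Ici
  have hN0 : N 0 ≤ M₁ := by
    refine le_trans (le_of_eq ?_) hM₁
    refine setLIntegral_congr_fun measurableSet_Ioi fun y hy => ?_
    simp [hg', hy.out]
  have hrec' : ∀ v, E' v ≤ e v + ∫⁻ y, E' (v - y) * g' y := by
    intro v
    rcases lt_or_ge v 0 with hv | hv
    · simp [hE', hv]
    · have h1 : E' v = E v := by simp [hE', hv]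
      have h2 : e v = A * N v := by simp [he, hv]
      rw [h1, h2]
      refine (hrec v hv).trans ?_
      have h3 : ∫⁻ y in Ioi 0, E (v - y) * g y
          = ∫⁻ y, ((Ioi v).indicator (fun y => E (v - y) * g' y) y + E' (v - y) * g' y) := by
        rw [← lintegral_indicator measurableSet_Ioi]
        refine lintegral_congr fun y => ?_
        simp only [indicator, hE', hg', mem_Ioi, mem_Ici]
        by_cases hy : 0 < y <;> by_cases hyv : v < y
        · have : ¬ (0 ≤ v - y) := by linarith
          simp [hy, hyv, not_le.2 hyv]
        · have : 0 ≤ v - y := by linarith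
          simp [hy, hyv, not_lt.1 hyv]
        · simp [hy]
        · simp [hy]
      rw [h3, lintegral_add_right _ (by fun_prop), lintegral_indicator measurableSet_Ioi]
      gcongr
      rw [hN]
      simp only
      rw [← lintegral_const_mul _ (by fun_prop)]
      refine setLIntegral_mono' measurableSet_Ioi fun y hy => ?_
      have hy : v < y := hy
      rw [← mul_assoc]
      gcongr
      refine (hneg _ (by linarith)).trans ?_
      gcongr
      linarith
  have hfin' : ∫⁻ v in Iic u, E' v ≠ ∞ := by
    rw [hE', setLIntegral_indicator measurableSet_Ici, Ici_inter_Iic]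
    exact hfin u
  have hg'1 : ∫⁻ y, g' y = 1 := by rw [hg', lintegral_indicator measurableSet_Ioi, hg1]
  have key := lintegral_mul_tail_le hE'm hem hg'm hg'1 u (fun v _ => hrec' v) hfin'
    (fun y hy => by simp [hg', hy.le])
  -- By Tonelli, the integral of `N` over `[0, ∞)` is the second moment of the step.
  have hsum : ∫⁻ v in Iic u, e v ≤ A * M₂ := by
    calc ∫⁻ v in Iic u, e v ≤ ∫⁻ v, e v := setLIntegral_le_lintegral _ _
      _ = A * ∫⁻ v in Ici 0, N v := by
        rw [he, lintegral_indicator measurableSet_Ici, lintegral_const_mul _ hNanti.measurable]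
      _ ≤ A * M₂ := by
        gcongr
        refine le_trans (le_of_eq ?_) hM₂
        have : ∀ v, N v = ∫⁻ y, {q : ℝ × ℝ | q.1 < q.2}.indicator
            (fun q => ENNReal.ofReal q.2 * g' q.2) (v, y) := by
          intro v
          simp only [hN]
          rw [← lintegral_indicator measurableSet_Ioi]
          rfl
        simp_rw [this]
        rw [lintegral_lintegral_swap, ← lintegral_indicator measurableSet_Ioi]
        · refine lintegral_congr fun y => ?_
          by_cases hy : 0 < y
          · have h6 : ∀ v, {q : ℝ × ℝ | q.1 < q.2}.indicator
                (fun q => ENNReal.ofReal q.2 * g' q.2) (v, y)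
                = (Iio y).indicator (fun _ => ENNReal.ofReal y * g y) v := by
              intro v
              simp [indicator, hg', hy]
            simp_rw [h6]
            rw [lintegral_indicator measurableSet_Iio, lintegral_const,
              Measure.restrict_restrict measurableSet_Iio, inter_comm, Ici_inter_Iio]
            simp [hy, mul_comm]
          · simp [hy, hg', indicator]
        · exact (Measurable.indicator (by fun_prop)
            (measurableSet_lt measurable_fst measurable_snd)).aemeasurable
  have hE'u : E' u = E u := by simp [hE', hu]
  rw [← hE'u]
  -- The hazard bound replaces the density `g' (u - v)` by the tail beyond `u - v`, which turns a
  -- pointwise convolution into the integral controlled by `key`.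
  calc E' u ≤ e u + ∫⁻ y, E' (u - y) * g' y := hrec' u
    _ = A * N u + ∫⁻ v, E' v * g' (u - v) := by
      congr 1
      · simp [he, hu]
      · rw [← lintegral_sub_left_eq_self _ u]
        simp
    _ ≤ A * M₁ + h * ∫⁻ v in Iic u, E' v * ∫⁻ y in Ioi (u - v), g' y := by
      gcongr
      · exact (hNanti hu).trans hN0
      · rw [← lintegral_const_mul' _ _ hh, ← lintegral_indicator measurableSet_Iic]
        refine lintegral_mono fun v => ?_
        by_cases hv : v ≤ u
        · simp only [indicator, mem_Iic, hv, if_true]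
          rw [mul_left_comm]
          gcongr
          have h7 : ∫⁻ y in Ioi (u - v), g' y = ∫⁻ y in Ioi (u - v), g y := by
            refine setLIntegral_congr_fun measurableSet_Ioi fun y hy => ?_
            have : 0 < y := lt_of_le_of_lt (by linarith) hy.out
            simp [hg', this]
          rw [h7]
          exact (indicator_le_self _ _ _).trans (hgh _ (by linarith))
        · have : ¬ (0 < u - v) := by linarith
          simp [indicator, hg', hv, this]
    _ ≤ A * M₁ + h * (A * M₂) := by gcongr; exact key.trans hsum
    _ = A * (M₁ + h * M₂) := by ring

/-! ### Two-sided bounds for the tilted solution of a defective renewal equation. -/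

theorem ofReal_integral_le_lintegral {α : Type*} [MeasurableSpace α] {μ : Measure α} (f : α → ℝ) :
    ENNReal.ofReal (∫ x, f x ∂μ) ≤ ∫⁻ x, ENNReal.ofReal (f x) ∂μ := by
  by_cases hf : Integrable f μ
  · rw [integral_eq_lintegral_pos_part_sub_lintegral_neg_part hf]
    refine (ENNReal.ofReal_le_ofReal (sub_le_self _ ENNReal.toReal_nonneg)).trans ?_
    exact ENNReal.ofReal_toReal_le
  · simp [integral_undef hf]

/-- Data of a defective renewal equation `ψ(u) = ∫ ψ(u - y) ρ(y) dy`, with `ψ = 1` on the negative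
half-line, adjustment coefficient `R`, and bounds on the tilted `k`-th moment and the hazard rate. -/
structure TiltedRenewal (ψ ρ : ℝ → ℝ) (k : ℕ) (R K H : ℝ) : Prop where
  measurable_sol : Measurable ψ
  sol_nonneg : ∀ u, 0 ≤ ψ u
  sol_le_one : ∀ u, ψ u ≤ 1
  sol_neg : ∀ u < 0, ψ u = 1
  measurable_step : Measurable ρ
  step_nonneg : ∀ y, 0 ≤ ρ y
  renewal : ∀ u, 0 ≤ u → ψ u = ∫ y in Ioi 0, ψ (u - y) * ρ y
  two_le : 2 ≤ k
  pos : 0 < R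
  integrable_tilt : IntegrableOn (fun y => Real.exp (R * y) * ρ y) (Ioi 0)
  integral_tilt : ∫ y in Ioi 0, Real.exp (R * y) * ρ y = 1
  integrable_moment : IntegrableOn (fun y => y ^ k * Real.exp (R * y) * ρ y) (Ioi 0)
  moment_le : ∫ y in Ioi 0, y ^ k * Real.exp (R * y) * ρ y ≤ K
  hazard_nonneg : 0 ≤ H
  hazard : ∀ y, 0 ≤ y → ρ y ≤ H * ∫ z in Ioi y, ρ z

namespace TiltedRenewal

variable {ψ ρ : ℝ → ℝ} {k : ℕ} {R K H : ℝ}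

theorem bound_nonneg (h : TiltedRenewal ψ ρ k R K H) : 0 ≤ K := by
  refine le_trans ?_ h.moment_le
  refine setIntegral_nonneg measurableSet_Ioi fun y hy => ?_
  have := h.step_nonneg y
  have hy : 0 < y := hy
  positivity

theorem integrableOn_step (h : TiltedRenewal ψ ρ k R K H) : IntegrableOn ρ (Ioi 0) := by
  refine h.integrable_tilt.mono' h.measurable_step.aestronglyMeasurable ?_
  filter_upwards [self_mem_ae_restrict measurableSet_Ioi] with y hy
  have hy : 0 < y := hy
  rw [Real.norm_of_nonneg (h.step_nonneg y)]
  exact le_mul_of_one_le_left (h.step_nonneg y) (Real.one_le_exp (by have := h.pos; positivity))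

/-- Lower tilted moments are bounded by the `k`-th one. -/
theorem lintegral_pow_le (h : TiltedRenewal ψ ρ k R K H) {j : ℕ} (hj : j ≤ k) :
    ∫⁻ y in Ioi 0, ENNReal.ofReal (y ^ j) * ENNReal.ofReal (Real.exp (R * y) * ρ y)
      ≤ ENNReal.ofReal (1 + K) := by
  have hint : IntegrableOn (fun y => Real.exp (R * y) * ρ y + y ^ k * Real.exp (R * y) * ρ y)
      (Ioi 0) := h.integrable_tilt.add h.integrable_moment
  have h1 : ∫ y in Ioi 0, (Real.exp (R * y) * ρ y + y ^ k * Real.exp (R * y) * ρ y) ≤ 1 + K := by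
    rw [integral_add h.integrable_tilt h.integrable_moment, h.integral_tilt]
    linarith [h.moment_le]
  refine le_trans ?_ (ENNReal.ofReal_le_ofReal h1)
  rw [ofReal_integral_eq_lintegral_ofReal hint]
  · refine setLIntegral_mono' measurableSet_Ioi fun y hy => ?_
    have hy : 0 < y := hy
    have hρ := h.step_nonneg y
    rw [← ENNReal.ofReal_mul (by positivity)]
    apply ENNReal.ofReal_le_ofReal
    have : y ^ j ≤ 1 + y ^ k := by
      rcases le_total y 1 with h1 | h1
      · have := pow_le_one₀ hy.le h1 (n := j)
        have : 0 ≤ y ^ k := by positivity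
        linarith
      · have := pow_le_pow_right₀ h1 hj
        linarith
    calc y ^ j * (Real.exp (R * y) * ρ y) ≤ (1 + y ^ k) * (Real.exp (R * y) * ρ y) := by gcongr
      _ = _ := by ring
  · filter_upwards [self_mem_ae_restrict measurableSet_Ioi] with y hy
    have hy : 0 < y := hy
    have hρ := h.step_nonneg y
    simp only [Pi.zero_apply]
    positivity

/-- Constants and `V(u) = e^{Ru} ψ(u)` both satisfy the undefective renewal equation with step
density `e^{Ry} ρ(y)`, hence so does `a - C V`. Its positive part satisfies the corresponding
inequality, to which `renewal_bound` applies with both step moments bounded by `1 + K`. On the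
negative half-line `V(v) = e^{Rv}`, so only an elementary inequality for exponentials remains to be
checked in each use. -/
theorem affine_bound (h : TiltedRenewal ψ ρ k R K H) {a C A : ℝ} (hA : 0 ≤ A)
    (hneg : ∀ v < 0, a - C * Real.exp (R * v) ≤ A * (-v)) (u : ℝ) (hu : 0 ≤ u) :
    a - C * (Real.exp (R * u) * ψ u) ≤ A * ((1 + K) * (1 + H)) := by
  have hK := h.bound_nonneg
  have hH := h.hazard_nonneg
  have hR := h.pos
  have hψm := h.measurable_sol
  have hρm := h.measurable_step
  set V : ℝ → ℝ := fun u => Real.exp (R * u) * ψ u with hV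
  have hVm : Measurable V := by fun_prop
  have hg0 : ∀ y, 0 ≤ Real.exp (R * y) * ρ y := fun y => by have := h.step_nonneg y; positivity
  have hren : ∀ u, 0 ≤ u →
      a - C * V u = ∫ y in Ioi 0, (a - C * V (u - y)) * (Real.exp (R * y) * ρ y) := by
    intro u hu
    have hi : IntegrableOn (fun y => Real.exp (R * u) * (ψ (u - y) * ρ y)) (Ioi 0) := by
      refine (h.integrableOn_step.mono' (by fun_prop) (ae_of_all _ fun y => ?_)).const_mul _
      rw [norm_mul, Real.norm_of_nonneg (h.sol_nonneg _), Real.norm_of_nonneg (h.step_nonneg _)]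
      exact mul_le_of_le_one_left (h.step_nonneg _) (h.sol_le_one _)
    have he : ∀ y, (a - C * V (u - y)) * (Real.exp (R * y) * ρ y)
        = a * (Real.exp (R * y) * ρ y) - C * (Real.exp (R * u) * (ψ (u - y) * ρ y)) := by
      intro y
      have : Real.exp (R * u) = Real.exp (R * (u - y)) * Real.exp (R * y) := by
        rw [← Real.exp_add]; congr 1; ring
      rw [this]; simp only [hV]; ring
    simp_rw [he]
    rw [integral_sub (h.integrable_tilt.const_mul _) (hi.const_mul _), integral_const_mul,
      integral_const_mul, integral_const_mul, h.integral_tilt, ← h.renewal u hu, mul_one]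
  have hb := renewal_bound (E := fun u => ENNReal.ofReal (a - C * V u))
    (g := fun y => ENNReal.ofReal (Real.exp (R * y) * ρ y)) (by fun_prop) (by fun_prop)
    (A := ENNReal.ofReal A) (h := ENNReal.ofReal H) (M₁ := ENNReal.ofReal (1 + K))
    (M₂ := ENNReal.ofReal (1 + K)) ENNReal.ofReal_ne_top ?_ ?_ ?_ ?_ ?_ ?_ ?_ u hu
  · rw [← ENNReal.ofReal_mul hH, ← ENNReal.ofReal_add (by positivity) (by positivity),
      ← ENNReal.ofReal_mul hA, ENNReal.ofReal_le_ofReal_iff (by positivity)] at hb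
    calc _ ≤ _ := hb
      _ = _ := by ring
  · rw [← ofReal_integral_eq_lintegral_ofReal h.integrable_tilt (ae_of_all _ hg0), h.integral_tilt,
      ENNReal.ofReal_one]
  · intro y hy
    rw [← ofReal_integral_eq_lintegral_ofReal
      (h.integrable_tilt.mono_set (Ioi_subset_Ioi hy)) (ae_of_all _ hg0), ← ENNReal.ofReal_mul hH]
    apply ENNReal.ofReal_le_ofReal
    -- Tilting preserves the hazard bound, since `e^{Ry} ≤ e^{Rz}` for `z > y`.
    calc Real.exp (R * y) * ρ y ≤ Real.exp (R * y) * (H * ∫ z in Ioi y, ρ z) := by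
          gcongr; exact h.hazard y hy
      _ = H * ∫ z in Ioi y, Real.exp (R * y) * ρ z := by rw [integral_const_mul]; ring
      _ ≤ _ := by
        refine mul_le_mul_of_nonneg_left ?_ hH
        refine setIntegral_mono_on
          ((h.integrableOn_step.mono_set (Ioi_subset_Ioi hy)).const_mul _)
          (h.integrable_tilt.mono_set (Ioi_subset_Ioi hy)) measurableSet_Ioi fun z hz => ?_
        have hz : y < z := hz
        have := h.step_nonneg z
        gcongr
  · simpa using h.lintegral_pow_le (j := 1) (by have := h.two_le; omega)
  · refine le_trans (le_of_eq ?_) (h.lintegral_pow_le h.two_le)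
    refine setLIntegral_congr_fun measurableSet_Ioi fun y hy => ?_
    have hy : 0 < y := hy
    rw [← mul_assoc, ← ENNReal.ofReal_mul hy.le, pow_two]
  · intro u hu
    rw [hren u hu]
    refine (ofReal_integral_le_lintegral _).trans (le_of_eq ?_)
    refine lintegral_congr fun y => ?_
    rw [ENNReal.ofReal_mul' (hg0 y)]
  · intro v hv
    rw [← ENNReal.ofReal_mul hA]
    apply ENNReal.ofReal_le_ofReal
    simpa [hV, h.sol_neg v hv] using hneg v hv
  · intro u
    refine ne_top_of_le_ne_top ?_ (setLIntegral_mono' (g := fun _ =>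
      ENNReal.ofReal (|a| + |C| * Real.exp (R * u))) measurableSet_Icc fun y hy => ?_)
    · simp [ENNReal.mul_eq_top]
    · apply ENNReal.ofReal_le_ofReal
      have h1 : |C * V y| ≤ |C| * Real.exp (R * u) := by
        rw [abs_mul]
        gcongr
        rw [abs_of_nonneg (by have := h.sol_nonneg y; positivity)]
        calc V y ≤ Real.exp (R * y) := mul_le_of_le_one_right (by positivity) (h.sol_le_one y)
          _ ≤ _ := by gcongr; exact hy.2
      have := neg_abs_le (C * V y)
      have := le_abs_self a
      linarith

/-- Lundberg's inequality: `V - 1` is nonpositive on the negative half-line, so `A = 0` is allowed.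
-/
theorem tilted_le_one (h : TiltedRenewal ψ ρ k R K H) (u : ℝ) (hu : 0 ≤ u) :
    Real.exp (R * u) * ψ u ≤ 1 := by
  have := h.affine_bound (a := -1) (C := -1) (A := 0) le_rfl (fun v hv => by
    have : Real.exp (R * v) ≤ 1 := Real.exp_le_one_iff.2 (by nlinarith [h.pos])
    linarith) u hu
  linarith

/-- Here `A = R`, from `1 - e^{Rv} ≤ -R v`. The factor `R` is the source of the term `θ` in the
error estimates. -/
theorem one_sub_tilted_le (h : TiltedRenewal ψ ρ k R K H) (u : ℝ) (hu : 0 ≤ u) :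
    1 - Real.exp (R * u) * ψ u ≤ R * ((1 + K) * (1 + H)) := by
  have := h.affine_bound (a := 1) (C := 1) h.pos.le (fun v _ => by
    have := Real.add_one_le_exp (R * v)
    linarith) u hu
  linarith

/-- The bound of `one_sub_tilted_le` says nothing about positivity when `R` is large. Scaling `V` by
`e^{Rb}` makes `1 - e^{R(b + v)}` nonpositive for `v ≥ -b`, so the slope `A = 1 / b` suffices, and
it can be made small. -/
theorem le_tilted (h : TiltedRenewal ψ ρ k R K H) (u : ℝ) (hu : 0 ≤ u) :
    Real.exp (-(R * (2 * ((1 + K) * (1 + H))))) / 2 ≤ Real.exp (R * u) * ψ u := by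
  have hK := h.bound_nonneg
  have hH := h.hazard_nonneg
  have hR := h.pos
  -- Chosen so that the resulting bound `(1 / b) (1 + K) (1 + H)` equals `1 / 2`.
  set b := 2 * ((1 + K) * (1 + H)) with hb
  have hbpos : 0 < b := by positivity
  have := h.affine_bound (a := 1) (C := Real.exp (R * b)) (A := 1 / b) (by positivity)
    (fun v hv => by
      rw [← Real.exp_add]
      rcases le_total (-b) v with hvb | hvb
      · have : 1 ≤ Real.exp (R * b + R * v) := Real.one_le_exp (by nlinarith)
        have : 0 ≤ 1 / b * (-v) := mul_nonneg (by positivity) (by linarith)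
        linarith
      · have : 1 ≤ 1 / b * (-v) := by
          rw [one_div, ← div_eq_inv_mul, le_div_iff₀ hbpos]; linarith
        have := Real.exp_pos (R * b + R * v)
        linarith) u hu
  have h2 : 1 / b * ((1 + K) * (1 + H)) = 1 / 2 := by
    rw [hb]; field_simp
  rw [h2] at this
  rw [Real.exp_neg, div_le_iff₀ two_pos, inv_le_iff_one_le_mul₀ (Real.exp_pos _)]
  linarith

end TiltedRenewal

/-! ### The renewal equation for the survival probability. -/

/-- Subfamilies of an independent family along index maps with disjoint ranges are independent. -/
theorem iIndepFun_indepFun_of_disjoint_range {Ω ι α β : Type*} [MeasurableSpace Ω] {P : Measure Ω}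
    {f : ι → Ω → ℝ} (hf : iIndepFun f P) (hm : ∀ i, Measurable (f i)) (s : α → ι) (t : β → ι)
    (hst : Disjoint (range s) (range t)) :
    IndepFun (fun ω a => f (s a) ω) (fun ω b => f (t b) ω) P := by
  have h := indep_iSup_of_disjoint (fun i => (hm i).comap_le) hf.iIndep hst
  rw [IndepFun_iff_Indep]
  refine indep_of_indep_of_le_left (indep_of_indep_of_le_right h ?_) ?_
  · refine Measurable.comap_le ?_
    refine @measurable_pi_lambda _ _ _ (_) _ _ fun b => ?_
    exact (comap_measurable (f (t b))).mono
      (le_iSup₂_of_le (t b) (mem_range_self b) le_rfl) le_rfl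
  · refine Measurable.comap_le ?_
    refine @measurable_pi_lambda _ _ _ (_) _ _ fun b => ?_
    exact (comap_measurable (f (s b))).mono
      (le_iSup₂_of_le (s b) (mem_range_self b) le_rfl) le_rfl

namespace RiskModel

variable {Ω : Type*} [MeasurableSpace Ω] {P : Measure Ω}

/-- The joint sequence of inter-arrival times and claims. -/
def driver (X : RiskModel Ω P) : ℕ ⊕ ℕ → Ω → ℝ := Sum.elim X.W X.Z

/-- Claim surplus at the time of the `n`-th claim, as a function of the driving sequence. -/
def claimSurplus (c : ℝ) (n : ℕ) (a : ℕ ⊕ ℕ → ℝ) : ℝ :=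
  ∑ i ∈ Finset.range n, (a (Sum.inr i) - c * a (Sum.inl i))

/-- The probability that the claim surplus never exceeds `u` at a claim time. -/
def survival (X : RiskModel Ω P) (u : ℝ) : ℝ≥0∞ :=
  P {ω | ∀ n, ∑ i ∈ Finset.range n, (X.Z i ω - X.c * X.W i ω) ≤ u}

theorem measurable_driver (X : RiskModel Ω P) (i : ℕ ⊕ ℕ) : Measurable (X.driver i) := by
  rcases i with i | i
  · exact X.measurable_W i
  · exact X.measurable_Z i

theorem measurable_claimSurplus (c : ℝ) (n : ℕ) : Measurable (claimSurplus c n) := by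
  unfold claimSurplus
  fun_prop

theorem claimSurplus_succ (c : ℝ) (n : ℕ) (a : ℕ ⊕ ℕ → ℝ) :
    claimSurplus c (n + 1) a = claimSurplus c n (fun i => a (Sum.map Nat.succ Nat.succ i))
      + (a (Sum.inr 0) - c * a (Sum.inl 0)) := by
  simp [claimSurplus, Finset.sum_range_succ']
  ring

theorem measurableSet_forall_claimSurplus (c u : ℝ) :
    MeasurableSet {a | ∀ n, claimSurplus c n a ≤ u} := by
  simp only [ofPred_forall]
  exact MeasurableSet.iInter fun n => measurableSet_le (measurable_claimSurplus c n) measurable_const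

theorem survival_eq_map (X : RiskModel Ω P) (u : ℝ) :
    X.survival u = P.map (fun ω i => X.driver i ω) {a | ∀ n, claimSurplus X.c n a ≤ u} := by
  rw [Measure.map_apply (measurable_pi_lambda _ X.measurable_driver)
    (measurableSet_forall_claimSurplus _ _)]
  rfl

/-- Dropping the first inter-arrival time and the first claim does not change the law. -/
theorem map_shift_driver (X : RiskModel Ω P) :
    P.map (fun ω i => X.driver (Sum.map Nat.succ Nat.succ i) ω)
      = P.map (fun ω i => X.driver i ω) := by
  have hinj : Function.Injective (Sum.map Nat.succ Nat.succ) :=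
    Nat.succ_injective.sumMap Nat.succ_injective
  have hi : iIndepFun X.driver P := X.indep
  rw [hi.map_fun_eq_infinitePi_map X.measurable_driver,
    (hi.precomp hinj).map_fun_eq_infinitePi_map fun i => X.measurable_driver _]
  congr 1
  funext i
  rcases i with i | i
  · exact (X.law_W _).trans (X.law_W _).symm
  · exact (X.ident_Z _).trans (X.ident_Z _).symm

theorem indepFun_first_shift (X : RiskModel Ω P) :
    IndepFun (fun ω => (X.W 0 ω, X.Z 0 ω))
      (fun ω i => X.driver (Sum.map Nat.succ Nat.succ i) ω) P := by
  have h := iIndepFun_indepFun_of_disjoint_range (f := X.driver) X.indep X.measurable_driver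
    (fun b : Bool => if b then Sum.inl 0 else Sum.inr 0) (Sum.map Nat.succ Nat.succ) (by
      rw [Set.disjoint_left]
      rintro _ ⟨b, rfl⟩ ⟨i, hi⟩
      rcases i with i | i <;> cases b <;> simp at hi)
  exact h.comp (φ := fun a : Bool → ℝ => (a true, a false)) (by fun_prop) measurable_id

theorem map_first (X : RiskModel Ω P) [IsProbabilityMeasure P] :
    P.map (fun ω => (X.W 0 ω, X.Z 0 ω)) = (expMeasure X.lam).prod (P.map (X.Z 0)) := by
  rw [← X.law_W 0]
  have : IndepFun (X.W 0) (X.Z 0) P :=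
    X.indep.indepFun (i := Sum.inl 0) (j := Sum.inr 0) (by simp)
  exact this.map_prod_eq_prod_map_map (X.measurable_W 0).aemeasurable (X.measurable_Z 0).aemeasurable

theorem survival_mono (X : RiskModel Ω P) : Monotone X.survival := fun _ _ h =>
  measure_mono fun _ hω n => (hω n).trans h

theorem survival_of_neg (X : RiskModel Ω P) {u : ℝ} (hu : u < 0) : X.survival u = 0 := by
  have : {ω | ∀ n, ∑ i ∈ Finset.range n, (X.Z i ω - X.c * X.W i ω) ≤ u} = ∅ := by
    ext ω
    simp only [mem_ofPred_eq, mem_empty_iff_false, iff_false, not_forall]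
    exact ⟨0, by simpa using hu⟩
  rw [survival, this, measure_empty]

theorem survival_le_one (X : RiskModel Ω P) [IsProbabilityMeasure P] (u : ℝ) : X.survival u ≤ 1 :=
  prob_le_one

/-- Conditioning on the first claim. -/
theorem survival_first_step (X : RiskModel Ω P) [IsProbabilityMeasure P] {u : ℝ} (hu : 0 ≤ u) :
    X.survival u
      = ∫⁻ w, ∫⁻ z, X.survival (u + X.c * w - z) ∂(P.map (X.Z 0)) ∂(expMeasure X.lam) := by
  have := isProbabilityMeasure_expMeasure X.lam_pos
  have := Measure.isProbabilityMeasure_map (μ := P) (X.measurable_Z 0).aemeasurable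
  have hm1 : Measurable (fun ω => (X.W 0 ω, X.Z 0 ω)) := (X.measurable_W 0).prodMk (X.measurable_Z 0)
  have hm2 : Measurable (fun ω i => X.driver (Sum.map Nat.succ Nat.succ i) ω) :=
    measurable_pi_lambda _ fun i => X.measurable_driver _
  -- Survival from `u`, expressed by the first pair and the shifted sequence, is survival from `u +
  -- c W₀ - Z₀`. The condition at `n = 0` of the original event is lost in the shift, but it holds
  -- because `0 ≤ u`.
  set B : Set ((ℝ × ℝ) × (ℕ ⊕ ℕ → ℝ)) :=
    {p | ∀ n, claimSurplus X.c n p.2 ≤ u + X.c * p.1.1 - p.1.2} with hB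
  have hBm : MeasurableSet B := by
    simp only [hB, ofPred_forall]
    exact MeasurableSet.iInter fun n => measurableSet_le
      ((measurable_claimSurplus _ _).comp measurable_snd) (by fun_prop)
  have h1 : X.survival u = P.map (fun ω => ((X.W 0 ω, X.Z 0 ω),
      fun i => X.driver (Sum.map Nat.succ Nat.succ i) ω)) B := by
    rw [Measure.map_apply (hm1.prodMk hm2) hBm]
    unfold survival
    congr 1
    ext ω
    simp only [hB, mem_ofPred_eq, mem_preimage]
    have hs : ∀ n, ∑ i ∈ Finset.range n, (X.Z i ω - X.c * X.W i ω)
        = claimSurplus X.c n (fun i => X.driver i ω) := fun n => rfl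
    constructor
    · intro h n
      have := h (n + 1)
      rw [hs, claimSurplus_succ] at this
      change _ + (X.Z 0 ω - X.c * X.W 0 ω) ≤ u at this
      linarith
    · intro h n
      rcases n with _ | n
      · simpa using hu
      · rw [hs, claimSurplus_succ]
        change _ + (X.Z 0 ω - X.c * X.W 0 ω) ≤ u
        linarith [h n]
  rw [h1, X.indepFun_first_shift.map_prod_eq_prod_map_map hm1.aemeasurable hm2.aemeasurable,
    X.map_shift_driver, X.map_first]
  have := Measure.isProbabilityMeasure_map (μ := P)
    (measurable_pi_lambda _ X.measurable_driver).aemeasurable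
  have hslice : ∀ p : ℝ × ℝ, P.map (fun ω i => X.driver i ω) (Prod.mk p ⁻¹' B)
      = X.survival (u + X.c * p.1 - p.2) := fun p => by
    rw [survival_eq_map]; rfl
  have hsm := X.survival_mono.measurable
  rw [Measure.prod_apply hBm]
  simp_rw [hslice]
  rw [lintegral_prod _ (Measurable.aemeasurable (by fun_prop))]

/-- The survival probability averaged over one claim. -/
noncomputable def survivalAfterClaim (X : RiskModel Ω P) (v : ℝ) : ℝ≥0∞ :=
  ∫⁻ z, X.survival (v - z) ∂(P.map (X.Z 0))

theorem survivalAfterClaim_mono (X : RiskModel Ω P) : Monotone X.survivalAfterClaim :=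
  fun _ _ h => lintegral_mono fun _ => X.survival_mono (by linarith)

theorem lintegral_expMeasure_comp {r c : ℝ} (hc : 0 < c) (u : ℝ) {f : ℝ → ℝ≥0∞}
    (hf : Measurable f) :
    ∫⁻ w, f (u + c * w) ∂(expMeasure r)
      = ∫⁻ s in Ici u, ENNReal.ofReal (r / c * Real.exp (-(r / c * (s - u)))) * f s := by
  have h1 : expMeasure r = volume.withDensity (exponentialPDF r) := rfl
  have hm : Measurable (exponentialPDF r) := by
    unfold exponentialPDF
    exact (measurable_exponentialPDFReal r).ennreal_ofReal
  rw [h1, lintegral_withDensity_eq_lintegral_mul _ hm (by fun_prop)]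
  have h2 : ∀ w, (exponentialPDF r * fun w => f (u + c * w)) w
      = (fun s => exponentialPDF r (s / c) * f (u + s)) (c * w) := by
    intro w
    simp [mul_div_cancel_left₀ _ hc.ne']
  simp_rw [h2]
  rw [← lintegral_map (f := fun s => exponentialPDF r (s / c) * f (u + s)) (g := fun w => c * w)
    (by fun_prop) (by fun_prop), Real.map_volume_mul_left hc.ne', lintegral_smul_measure,
    smul_eq_mul, ← lintegral_const_mul _ (by fun_prop), ← lintegral_indicator measurableSet_Ici,
    ← lintegral_add_left_eq_self ((Ici u).indicator _) u]
  refine lintegral_congr fun s => ?_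
  simp only [indicator, mem_Ici, exponentialPDF_eq, le_add_iff_nonneg_right]
  by_cases hs : 0 ≤ s
  · have : 0 ≤ s / c := by positivity
    rw [if_pos hs, if_pos this, ← mul_assoc, ← ENNReal.ofReal_mul (by positivity),
      abs_of_pos (by positivity)]
    congr 2
    have : r * (s / c) = r / c * (u + s - u) := by field_simp; ring
    rw [this]
    field_simp
  · have : ¬ 0 ≤ s / c := by
      rw [not_le] at hs ⊢
      exact div_neg_of_neg_of_pos hs hc
    simp [hs, this]

theorem survival_eq_setLIntegral (X : RiskModel Ω P) [IsProbabilityMeasure P] {u : ℝ}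
    (hu : 0 ≤ u) :
    X.survival u = ∫⁻ s in Ici u, ENNReal.ofReal (X.lam / X.c *
      Real.exp (-(X.lam / X.c * (s - u)))) * X.survivalAfterClaim s := by
  rw [X.survival_first_step hu]
  exact lintegral_expMeasure_comp X.c_pos u X.survivalAfterClaim_mono.measurable

end RiskModel

theorem setLIntegral_Ioc_exp {q : ℝ} (hq : 0 < q) (s : ℝ) {m : ℝ} (hm : 0 ≤ m) :
    ∫⁻ v in Ioc 0 m, ENNReal.ofReal (q * Real.exp (-(q * (s - v))))
      = ENNReal.ofReal (Real.exp (-(q * (s - m))) - Real.exp (-(q * s))) := by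
  have hd : ∀ v, HasDerivAt (fun v => Real.exp (-(q * (s - v))))
      (q * Real.exp (-(q * (s - v)))) v := by
    intro v
    have : HasDerivAt (fun v => -(q * (s - v))) q v := by
      convert! (((hasDerivAt_id v).const_sub s).const_mul q).neg using 1
      simp
    simpa [mul_comm] using this.exp
  have hc : Continuous fun v => q * Real.exp (-(q * (s - v))) := by fun_prop
  rw [← ofReal_integral_eq_lintegral_ofReal (hc.integrableOn_Ioc)
    (ae_of_all _ fun v => by positivity), ← intervalIntegral.integral_of_le hm,
    intervalIntegral.integral_eq_sub_of_hasDerivAt (fun v _ => hd v)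
      (hc.intervalIntegrable _ _)]
  simp

/-- Integrated form of the differential equation solved by an exponential moving average. -/
theorem exp_average_integral_eq {q : ℝ} (hq : 0 < q) {φ h : ℝ → ℝ≥0∞} (hh : Measurable h)
    (hφ : ∀ u, 0 ≤ u → φ u = ∫⁻ s in Ici u, ENNReal.ofReal (q * Real.exp (-(q * (s - u)))) * h s)
    {u : ℝ} (hu : 0 ≤ u) :
    φ 0 + ENNReal.ofReal q * ∫⁻ v in Ioc 0 u, φ v
      = φ u + ENNReal.ofReal q * ∫⁻ s in Ico 0 u, h s := by
  set κ : ℝ → ℝ → ℝ≥0∞ := fun v s =>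
    (Ici v).indicator (fun s => ENNReal.ofReal (q * Real.exp (-(q * (s - v))))) s with hκ
  have hκm : Measurable fun p : ℝ × ℝ => κ p.1 p.2 := by
    have : (fun p : ℝ × ℝ => κ p.1 p.2) = {p : ℝ × ℝ | p.1 ≤ p.2}.indicator
        (fun p => ENNReal.ofReal (q * Real.exp (-(q * (p.2 - p.1))))) := by
      ext p; simp [hκ, indicator]
    rw [this]
    exact Measurable.indicator (by fun_prop) (measurableSet_le measurable_fst measurable_snd)
  have hκ1 : ∀ v, Measurable fun s => κ v s := fun v => hκm.comp measurable_prodMk_left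
  have hφ' : ∀ v, 0 ≤ v → φ v = ∫⁻ s, κ v s * h s := by
    intro v hv
    rw [hφ v hv, ← lintegral_indicator measurableSet_Ici]
    refine lintegral_congr fun s => ?_
    by_cases hs : v ≤ s <;> simp [hκ, indicator, hs]
  -- The integrated form of `φ' = q φ - q h` reduces to this identity between kernels, checked at
  -- each `s`. All terms are kept on the side where they are positive, so that no subtraction in
  -- `ℝ≥0∞` occurs.
  have hpt : ∀ s, κ 0 s + ENNReal.ofReal q * ∫⁻ v in Ioc 0 u, κ v s
      = κ u s + ENNReal.ofReal q * (Ico 0 u).indicator 1 s := by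
    intro s
    have hswap : ∫⁻ v in Ioc 0 u, κ v s
        = ∫⁻ v in Ioc 0 (min u s), ENNReal.ofReal (q * Real.exp (-(q * (s - v)))) := by
      rw [← lintegral_indicator measurableSet_Ioc, ← lintegral_indicator measurableSet_Ioc]
      refine lintegral_congr fun v => ?_
      simp only [hκ, indicator, mem_Ioc, mem_Ici, le_min_iff]
      by_cases h1 : 0 < v <;> by_cases h2 : v ≤ u <;> by_cases h3 : v ≤ s <;> simp [h1, h2, h3]
    rw [hswap]
    rcases lt_or_ge s 0 with hs | hs
    · have h1 : ¬ u ≤ s := by linarith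
      have h2 : Ioc 0 (min u s) = ∅ := Ioc_eq_empty (by simp [hs.le])
      rw [h2]
      simp [hκ, hs, h1]
    · rw [setLIntegral_Ioc_exp hq s (le_min hu hs), ← ENNReal.ofReal_mul hq.le]
      have hk0 : κ 0 s = ENNReal.ofReal (q * Real.exp (-(q * s))) := by simp [hκ, hs]
      have hmono : Real.exp (-(q * s)) ≤ Real.exp (-(q * (s - min u s))) := by
        apply Real.exp_le_exp.2
        have := le_min hu hs
        nlinarith
      rw [hk0, ← ENNReal.ofReal_add (by positivity) (by nlinarith)]
      rcases lt_or_ge s u with hsu | hsu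
      · have h1 : ¬ u ≤ s := by linarith
        have : κ u s = 0 := by simp [hκ, h1]
        rw [this, min_eq_right hsu.le]
        simp only [sub_self, mul_zero, neg_zero, Real.exp_zero, mem_Ico, hs, hsu, and_self,
          indicator_of_mem, Pi.one_apply, mul_one, zero_add]
        congr 1
        ring
      · have : κ u s = ENNReal.ofReal (q * Real.exp (-(q * (s - u)))) := by simp [hκ, hsu]
        rw [this, min_eq_left hsu]
        simp only [mem_Ico, hsu.not_gt, and_false, not_false_eq_true, indicator_of_notMem, mul_zero,
          add_zero]
        congr 1
        ring
  have hi1 : ∫⁻ v in Ioc 0 u, φ v = ∫⁻ s, (∫⁻ v in Ioc 0 u, κ v s) * h s := by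
    rw [setLIntegral_congr_fun measurableSet_Ioc fun v hv => hφ' v hv.1.le,
      lintegral_lintegral_swap (hκm.mul (hh.comp measurable_snd)).aemeasurable]
    refine lintegral_congr fun s => ?_
    rw [lintegral_mul_const]
    exact hκm.comp measurable_prodMk_right
  have hmI : Measurable fun s => ∫⁻ v in Ioc 0 u, κ v s := Measurable.lintegral_prod_left' hκm
  have hi2 : ∫⁻ s in Ico 0 u, h s = ∫⁻ s, (Ico 0 u).indicator 1 s * h s := by
    rw [← lintegral_indicator measurableSet_Ico]
    refine lintegral_congr fun s => ?_
    by_cases hs : s ∈ Ico 0 u <;> simp [hs]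
  have hm0 : Measurable fun s => κ 0 s * h s := (hκ1 0).mul hh
  have hmu : Measurable fun s => κ u s * h s := (hκ1 u).mul hh
  have hmIh : Measurable fun s => (∫⁻ v in Ioc 0 u, κ v s) * h s := hmI.mul hh
  have hmJ : Measurable fun s => (Ico 0 u).indicator 1 s * h s :=
    (measurable_one.indicator measurableSet_Ico).mul hh
  rw [hi1, hi2, hφ' 0 le_rfl, hφ' u hu, ← lintegral_const_mul _ hmIh,
    ← lintegral_const_mul _ hmJ,
    ← lintegral_add_left hm0, ← lintegral_add_left hmu]
  refine lintegral_congr fun s => ?_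
  rw [← mul_assoc, ← mul_assoc, ← add_mul, ← add_mul, hpt]

namespace RiskModel

variable {Ω : Type*} [MeasurableSpace Ω] {P : Measure Ω}

/-- The tail `P(Z > y)` of the claim distribution. -/
noncomputable def tail (X : RiskModel Ω P) (y : ℝ) : ℝ≥0∞ := P.map (X.Z 0) (Ioi y)

theorem tail_anti (X : RiskModel Ω P) : Antitone X.tail := fun _ _ h =>
  measure_mono (Ioi_subset_Ioi h)

/-- Tonelli and the substitution `x = v - z`. The constraint `0 < x + z` may be dropped, since
claims are positive and survival vanishes at negative reserves. -/
theorem setLIntegral_survivalAfterClaim (X : RiskModel Ω P) [IsProbabilityMeasure P] (u : ℝ) :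
    ∫⁻ v in Ioc 0 u, X.survivalAfterClaim v
      = ∫⁻ x in Iic u, X.survival x * P.map (X.Z 0) (Iic (u - x)) := by
  have := Measure.isProbabilityMeasure_map (μ := P) (X.measurable_Z 0).aemeasurable
  have hsm := X.survival_mono.measurable
  unfold survivalAfterClaim
  rw [lintegral_lintegral_swap (Measurable.aemeasurable (by fun_prop))]
  have hpos : ∀ᵐ z ∂(P.map (X.Z 0)), 0 < z := by
    rw [ae_map_iff (X.measurable_Z 0).aemeasurable measurableSet_Ioi]
    exact X.pos_Z 0
  have h1 : ∀ᵐ z ∂(P.map (X.Z 0)), ∫⁻ v in Ioc 0 u, X.survival (v - z)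
      = ∫⁻ x in Iic u, {p : ℝ × ℝ | p.1 ≤ u - p.2}.indicator (fun p => X.survival p.2) (z, x) := by
    filter_upwards [hpos] with z hz
    rw [← lintegral_indicator measurableSet_Ioc, ← lintegral_indicator measurableSet_Iic,
      ← lintegral_add_right_eq_self _ z]
    refine lintegral_congr fun x => ?_
    simp only [indicator, mem_Ioc, mem_Iic, mem_ofPred_eq, add_sub_cancel_right]
    rcases lt_or_ge x 0 with hx | hx
    · simp [X.survival_of_neg hx]
    · have h1 : 0 < x + z := by linarith
      by_cases h2 : x + z ≤ u
      · have h3 : x ≤ u := by linarith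
        have h4 : z ≤ u - x := by linarith
        simp [h1, h2, h3, h4]
      · have h4 : ¬ z ≤ u - x := by intro; apply h2; linarith
        simp [h2, h4]
  rw [lintegral_congr_ae h1, lintegral_lintegral_swap]
  · refine lintegral_congr fun x => ?_
    have : ∀ z, {p : ℝ × ℝ | p.1 ≤ u - p.2}.indicator (fun p => X.survival p.2) (z, x)
        = (Iic (u - x)).indicator (fun _ => X.survival x) z := fun z => by simp [indicator]
    simp_rw [this]
    rw [lintegral_indicator measurableSet_Iic, lintegral_const, Measure.restrict_apply_univ]
  · exact (Measurable.indicator (by fun_prop)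
      (measurableSet_le measurable_fst (by fun_prop))).aemeasurable

/-- The renewal equation for the survival probability. -/
theorem survival_renewal (X : RiskModel Ω P) [IsProbabilityMeasure P] {u : ℝ} (hu : 0 ≤ u) :
    X.survival u = X.survival 0
      + ENNReal.ofReal (X.lam / X.c) * ∫⁻ y in Ioi 0, X.survival (u - y) * X.tail y := by
  have := Measure.isProbabilityMeasure_map (μ := P) (X.measurable_Z 0).aemeasurable
  have hsm := X.survival_mono.measurable
  have hTm := X.tail_anti.measurable
  have hq : 0 < X.lam / X.c := div_pos X.lam_pos X.c_pos
  have h := exp_average_integral_eq hq X.survivalAfterClaim_mono.measurable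
    (fun v hv => X.survival_eq_setLIntegral hv) hu
  rw [setLIntegral_congr Ico_ae_eq_Ioc, X.setLIntegral_survivalAfterClaim] at h
  have hG : Measurable fun x => P.map (X.Z 0) (Iic (u - x)) := by
    refine Antitone.measurable fun a b hab => measure_mono (Iic_subset_Iic.2 (by linarith))
  -- Inserting `1 = P(Z > u - x) + P(Z ≤ u - x)` makes the second part cancel against the claim term
  -- of `h`, leaving only the convolution with the tail.
  have h2 : ∫⁻ v in Ioc 0 u, X.survival v
      = (∫⁻ x in Iic u, X.survival x * X.tail (u - x))
        + ∫⁻ x in Iic u, X.survival x * P.map (X.Z 0) (Iic (u - x)) := by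
    have hm : Measurable fun x => X.survival x * P.map (X.Z 0) (Iic (u - x)) := hsm.mul hG
    rw [← lintegral_add_right _ hm, ← setLIntegral_congr Ico_ae_eq_Ioc,
      setLIntegral_congr Ico_ae_eq_Icc,
      ← lintegral_indicator measurableSet_Icc, ← lintegral_indicator measurableSet_Iic]
    refine lintegral_congr fun x => ?_
    have h3 : X.tail (u - x) + P.map (X.Z 0) (Iic (u - x)) = 1 := by
      rw [tail, ← compl_Iic, add_comm, measure_add_measure_compl measurableSet_Iic, measure_univ]
    simp only [indicator, mem_Icc, mem_Iic, ← mul_add, h3, mul_one]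
    rcases lt_or_ge x 0 with hx | hx
    · simp [X.survival_of_neg hx]
    · simp [hx]
  have hfin : ∫⁻ x in Iic u, X.survival x * P.map (X.Z 0) (Iic (u - x)) ≠ ∞ := by
    have h4 : ∫⁻ v in Ioc 0 u, X.survival v ≠ ∞ := by
      refine ne_top_of_le_ne_top ?_ (lintegral_mono (g := fun _ => 1) fun v => X.survival_le_one v)
      simp
    exact ne_top_of_le_ne_top h4 (h2 ▸ le_add_self)
  have h5 : ∫⁻ x in Iic u, X.survival x * X.tail (u - x)
      = ∫⁻ y in Ioi 0, X.survival (u - y) * X.tail y := by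
    rw [setLIntegral_congr (Ioi_ae_eq_Ici (a := (0 : ℝ))), ← lintegral_indicator measurableSet_Ici,
      ← lintegral_indicator measurableSet_Iic, ← lintegral_sub_left_eq_self _ u]
    refine lintegral_congr fun y => ?_
    simp [indicator]
  rw [h2, h5, mul_add, ← add_assoc] at h
  exact ((ENNReal.add_left_inj (ENNReal.mul_ne_top ENNReal.ofReal_ne_top hfin)).1 h).symm

end RiskModel

/-! ### Ruin at claim times and the net profit condition. -/

open Filter
open scoped Topology

theorem expMeasure_Iic {r : ℝ} {t : ℝ} (hr : 0 < r) (ht : 0 ≤ t) :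
    expMeasure r (Iic t) = ENNReal.ofReal (1 - Real.exp (-(r * t))) := by
  have h1 : expMeasure r = volume.withDensity (exponentialPDF r) := rfl
  rw [h1, withDensity_apply _ measurableSet_Iic, lintegral_exponentialPDF_eq_antiDeriv hr, if_pos ht]

theorem expMeasure_Ioi {r : ℝ} {t : ℝ} (hr : 0 < r) (ht : 0 ≤ t) :
    expMeasure r (Ioi t) = ENNReal.ofReal (Real.exp (-(r * t))) := by
  have := isProbabilityMeasure_expMeasure hr
  have h1 : Real.exp (-(r * t)) ≤ 1 := Real.exp_le_one_iff.2 (by nlinarith)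
  rw [← compl_Iic, prob_compl_eq_one_sub measurableSet_Iic, expMeasure_Iic hr ht,
    ← ENNReal.ofReal_one, ← ENNReal.ofReal_sub _ (by linarith)]
  congr 1
  ring

namespace RiskModel

variable {Ω : Type*} [MeasurableSpace Ω] {P : Measure Ω}

theorem measure_W_le (X : RiskModel Ω P) (i : ℕ) {t : ℝ} (ht : 0 ≤ t) :
    P {ω | X.W i ω ≤ t} = ENNReal.ofReal (1 - Real.exp (-(X.lam * t))) := by
  rw [← expMeasure_Iic X.lam_pos ht, ← X.law_W i, Measure.map_apply (X.measurable_W i)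
    measurableSet_Iic]
  rfl

theorem measure_lt_W (X : RiskModel Ω P) (i : ℕ) {t : ℝ} (ht : 0 ≤ t) :
    P {ω | t < X.W i ω} = ENNReal.ofReal (Real.exp (-(X.lam * t))) := by
  rw [← expMeasure_Ioi X.lam_pos ht, ← X.law_W i, Measure.map_apply (X.measurable_W i)
    measurableSet_Ioi]
  rfl

theorem ae_W_pos (X : RiskModel Ω P) : ∀ᵐ ω ∂P, ∀ i, 0 < X.W i ω := by
  rw [ae_all_iff]
  intro i
  rw [ae_iff]
  simpa using X.measure_W_le i le_rfl

theorem measurable_arrival (X : RiskModel Ω P) (n : ℕ) : Measurable (X.arrival n) := by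
  have := X.measurable_W
  unfold arrival
  fun_prop

/-- If the sum of `n` positive waiting times is at most `t`, so is each of them. This crude bound
decays geometrically in `n` and is `O(tⁿ)` for small `t`, which is all that is used later. -/
theorem measure_arrival_le (X : RiskModel Ω P) (n : ℕ) {t : ℝ} (ht : 0 ≤ t) :
    P {ω | X.arrival n ω ≤ t} ≤ ENNReal.ofReal (1 - Real.exp (-(X.lam * t))) ^ n := by
  have hi : iIndepFun X.W P := X.indep.precomp (g := Sum.inl) Sum.inl_injective
  have h1 : P (⋂ i ∈ Finset.range n, {ω | X.W i ω ≤ t})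
      = ∏ i ∈ Finset.range n, P {ω | X.W i ω ≤ t} :=
    hi.meas_biInter fun i _ => ⟨Iic t, measurableSet_Iic, rfl⟩
  simp_rw [fun i => X.measure_W_le i ht, Finset.prod_const, Finset.card_range] at h1
  rw [← h1]
  refine measure_mono_ae ?_
  filter_upwards [X.ae_W_pos] with ω hω (hle : X.arrival n ω ≤ t)
  refine mem_iInter₂.2 fun i hi => ?_
  exact (Finset.single_le_sum (f := fun i => X.W i ω) (fun j _ => (hω j).le) hi).trans hle

/-- The arrival times increase strictly to infinity. -/
def Regular (X : RiskModel Ω P) (ω : Ω) : Prop :=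
  (∀ i, 0 < X.W i ω) ∧ ∀ t, ∃ n, t < X.arrival n ω

theorem ae_regular (X : RiskModel Ω P) : ∀ᵐ ω ∂P, X.Regular ω := by
  refine X.ae_W_pos.and ?_
  have h : ∀ᵐ ω ∂P, ∀ N : ℕ, ∃ n, (N : ℝ) < X.arrival n ω := by
    rw [ae_all_iff]
    intro N
    rw [ae_iff]
    have hlim : Tendsto (fun n : ℕ => ENNReal.ofReal (1 - Real.exp (-(X.lam * N))) ^ n) atTop
        (𝓝 0) := by
      apply ENNReal.tendsto_pow_atTop_nhds_zero_of_lt_one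
      rw [ENNReal.ofReal_lt_one]
      linarith [Real.exp_pos (-(X.lam * N))]
    refine le_antisymm (ge_of_tendsto' hlim fun n => ?_) (zero_le)
    refine le_trans (measure_mono fun ω hω => ?_) (X.measure_arrival_le n (Nat.cast_nonneg N))
    simp only [not_exists, not_lt, mem_ofPred_eq] at hω
    exact hω n
  filter_upwards [h] with ω hω t
  obtain ⟨N, hN⟩ := exists_nat_gt t
  obtain ⟨n, hn⟩ := hω N
  exact ⟨n, hN.trans hn⟩

theorem Regular.strictMono_arrival {X : RiskModel Ω P} {ω : Ω} (h : X.Regular ω) :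
    StrictMono fun n => X.arrival n ω := by
  refine strictMono_nat_of_lt_succ fun n => ?_
  simp only [arrival, Finset.sum_range_succ]
  linarith [h.1 n]

theorem arrival_zero (X : RiskModel Ω P) (ω : Ω) : X.arrival 0 ω = 0 := by simp [arrival]

theorem Regular.count_eq {X : RiskModel Ω P} {ω : Ω} (h : X.Regular ω) {t : ℝ} {n : ℕ}
    (h1 : X.arrival n ω ≤ t) (h2 : t < X.arrival (n + 1) ω) : X.count t ω = n := by
  have : {m : ℕ | X.arrival (m + 1) ω ≤ t} = (Finset.range n : Set ℕ) := by
    ext m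
    simp only [mem_ofPred_eq, Finset.coe_range, mem_Iio]
    constructor
    · intro hm
      have := h.strictMono_arrival.lt_iff_lt.1 (hm.trans_lt h2)
      omega
    · intro hm
      exact (h.strictMono_arrival.monotone (show m + 1 ≤ n from hm)).trans h1
  rw [count, this, ncard_coe_finset, Finset.card_range]

theorem Regular.exists_arrival {X : RiskModel Ω P} {ω : Ω} (h : X.Regular ω) {t : ℝ}
    (ht : 0 ≤ t) : ∃ n, X.arrival n ω ≤ t ∧ t < X.arrival (n + 1) ω := by
  classical
  have hex := h.2 t
  have h0 : Nat.find hex ≠ 0 := by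
    intro h0
    have := Nat.find_spec hex
    rw [h0, arrival_zero] at this
    linarith
  obtain ⟨n, hn⟩ := Nat.exists_eq_succ_of_ne_zero h0
  refine ⟨n, not_lt.1 (Nat.find_min hex (by omega)), ?_⟩
  have := Nat.find_spec hex
  rwa [hn] at this

/-- The reserve increases between claims, so it becomes negative if and only if it is negative at
some claim time. -/
theorem Regular.ruinTime_lt_top_iff {X : RiskModel Ω P} {ω : Ω} (h : X.Regular ω) (u : ℝ) :
    X.ruinTime u ω < ∞ ↔ ∃ n, u < ∑ i ∈ Finset.range n, (X.Z i ω - X.c * X.W i ω) := by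
  have hsum : ∀ n, ∑ i ∈ Finset.range n, (X.Z i ω - X.c * X.W i ω)
      = ∑ i ∈ Finset.range n, X.Z i ω - X.c * X.arrival n ω := fun n => by
    rw [Finset.sum_sub_distrib, ← Finset.mul_sum]; rfl
  simp only [ruinTime, iInf_lt_top, ENNReal.coe_lt_top, exists_prop, and_true, hsum]
  constructor
  · rintro ⟨t, ht⟩
    obtain ⟨n, hn⟩ := h.exists_arrival t.coe_nonneg
    refine ⟨n, ?_⟩
    rw [reserve, h.count_eq hn.1 hn.2] at ht
    have := mul_le_mul_of_nonneg_left hn.1 X.c_pos.le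
    linarith
  · rintro ⟨n, hn⟩
    have h0 : 0 ≤ X.arrival n ω := by
      rw [← X.arrival_zero ω]; exact h.strictMono_arrival.monotone (Nat.zero_le n)
    refine ⟨(X.arrival n ω).toNNReal, ?_⟩
    rw [reserve, Real.coe_toNNReal _ h0, h.count_eq le_rfl (h.strictMono_arrival (Nat.lt_succ_self n))]
    linarith

theorem ruinProb_eq (X : RiskModel Ω P) [IsProbabilityMeasure P] (u : ℝ) :
    X.ruinProb u = 1 - (X.survival u).toReal := by
  have hW := X.measurable_W
  have hZ := X.measurable_Z
  set B : Set Ω := {ω | ∀ n, ∑ i ∈ Finset.range n, (X.Z i ω - X.c * X.W i ω) ≤ u} with hB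
  have hBm : MeasurableSet B := by
    simp only [hB, ofPred_forall]
    exact MeasurableSet.iInter fun n => measurableSet_le (by fun_prop) measurable_const
  have h1 : ({ω | X.ruinTime u ω < ∞} : Set Ω) =ᵐ[P] (Bᶜ : Set Ω) := by
    filter_upwards [X.ae_regular] with ω hω
    have := hω.ruinTime_lt_top_iff u
    apply propext
    change X.ruinTime u ω < ∞ ↔ ¬ (∀ n, ∑ i ∈ Finset.range n, (X.Z i ω - X.c * X.W i ω) ≤ u)
    rw [this]
    push Not
    rfl
  rw [ruinProb, measureReal_congr h1, probReal_compl_eq_one_sub hBm]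
  rfl

theorem lintegral_W (X : RiskModel Ω P) (i : ℕ) :
    ∫⁻ ω, ENNReal.ofReal (X.W i ω) ∂P = ENNReal.ofReal (1 / X.lam) := by
  have hl := X.lam_pos
  rw [lintegral_eq_lintegral_meas_lt P
    (by filter_upwards [X.ae_W_pos] with ω hω using (hω i).le) (X.measurable_W i).aemeasurable,
    setLIntegral_congr_fun measurableSet_Ioi fun t ht => X.measure_lt_W i (le_of_lt ht)]
  have he : ∀ t, -(X.lam * t) = -X.lam * t := fun t => by ring
  simp_rw [he]
  rw [← ofReal_integral_eq_lintegral_ofReal (integrableOn_exp_mul_Ioi (by linarith) 0)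
    (ae_of_all _ fun t => (Real.exp_pos _).le), integral_exp_mul_Ioi (by linarith)]
  simp

theorem integrable_W (X : RiskModel Ω P) (i : ℕ) : Integrable (X.W i) P := by
  refine ⟨(X.measurable_W i).aestronglyMeasurable, ?_⟩
  rw [hasFiniteIntegral_iff_ofReal
    (by filter_upwards [X.ae_W_pos] with ω hω using (hω i).le), X.lintegral_W]
  exact ENNReal.ofReal_lt_top

theorem integral_W (X : RiskModel Ω P) (i : ℕ) : ∫ ω, X.W i ω ∂P = 1 / X.lam := by
  have hl := X.lam_pos
  rw [integral_eq_lintegral_of_nonneg_ae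
    (by filter_upwards [X.ae_W_pos] with ω hω using (hω i).le)
    (X.measurable_W i).aestronglyMeasurable, X.lintegral_W, ENNReal.toReal_ofReal (by positivity)]

/-- Under the net profit condition the claim surplus is almost surely bounded above. -/
theorem ae_claimSurplus_bounded (X : RiskModel Ω P) (hZ : Integrable (X.Z 0) P)
    (hprofit : X.lam * X.moment 1 < X.c) :
    ∀ᵐ ω ∂P, ∃ N : ℕ, ∀ n, ∑ i ∈ Finset.range n, (X.Z i ω - X.c * X.W i ω) ≤ N := by
  have hl := X.lam_pos
  have hWi : ∀ i, IdentDistrib (X.W i) (X.W 0) P P := fun i =>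
    ⟨(X.measurable_W i).aemeasurable, (X.measurable_W 0).aemeasurable,
      (X.law_W i).trans (X.law_W 0).symm⟩
  have hZi : ∀ i, IdentDistrib (X.Z i) (X.Z 0) P P := fun i =>
    ⟨(X.measurable_Z i).aemeasurable, (X.measurable_Z 0).aemeasurable, X.ident_Z i⟩
  have h1 := strong_law_ae_real X.W (X.integrable_W 0)
    (fun i j hij => X.indep.indepFun (i := Sum.inl i) (j := Sum.inl j) (by simpa using hij)) hWi
  have h2 := strong_law_ae_real X.Z hZ
    (fun i j hij => X.indep.indepFun (i := Sum.inr i) (j := Sum.inr j) (by simpa using hij)) hZi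
  filter_upwards [h1, h2] with ω hω1 hω2
  have h3 := hω2.sub (hω1.const_mul X.c)
  rw [X.integral_W] at h3
  have hm : ∫ ω, X.Z 0 ω ∂P = X.moment 1 := by simp [moment]
  rw [hm] at h3
  have hneg : X.moment 1 - X.c * (1 / X.lam) < 0 := by
    rw [mul_one_div, sub_neg, lt_div_iff₀ hl]
    linarith
  -- By the law of large numbers the surplus divided by `n` tends to `m₁ - c / λ < 0`; only finitely
  -- many partial sums can be positive.
  obtain ⟨n₀, hn₀⟩ := eventually_atTop.1 (h3.eventually (gt_mem_nhds hneg))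
  set S : ℕ → ℝ := fun n => ∑ i ∈ Finset.range n, (X.Z i ω - X.c * X.W i ω) with hS
  have hSn : ∀ n, n₀ ≤ n → S n ≤ 0 := by
    intro n hn
    have := hn₀ n hn
    rw [← mul_div_assoc, ← sub_div, Finset.mul_sum, ← Finset.sum_sub_distrib] at this
    by_contra hpos
    push Not at hpos
    have : 0 ≤ S n / n := by positivity
    linarith
  obtain ⟨N, hN⟩ := exists_nat_gt (∑ n ∈ Finset.range n₀, |S n|)
  refine ⟨N, fun n => ?_⟩
  rcases lt_or_ge n n₀ with hn | hn
  · have := Finset.single_le_sum (f := fun n => |S n|) (fun j _ => abs_nonneg _)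
      (Finset.mem_range.2 hn)
    have := le_abs_self (S n)
    change S n ≤ N
    linarith
  · exact (hSn n hn).trans (Nat.cast_nonneg N)

theorem tendsto_survival (X : RiskModel Ω P) [IsProbabilityMeasure P] (hZ : Integrable (X.Z 0) P)
    (hprofit : X.lam * X.moment 1 < X.c) :
    Tendsto (fun N : ℕ => X.survival N) atTop (𝓝 1) := by
  have h1 := tendsto_measure_iUnion_atTop (μ := P)
    (s := fun N : ℕ => {ω | ∀ n, ∑ i ∈ Finset.range n, (X.Z i ω - X.c * X.W i ω) ≤ N})
    (fun a b hab ω hω n => (hω n).trans (by exact_mod_cast hab))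
  have h2 : P (⋃ N : ℕ, {ω | ∀ n, ∑ i ∈ Finset.range n, (X.Z i ω - X.c * X.W i ω) ≤ N}) = 1 := by
    rw [← measure_univ (μ := P)]
    refine measure_congr ?_
    filter_upwards [X.ae_claimSurplus_bounded hZ hprofit] with ω hω
    apply propext
    exact ⟨fun _ => trivial, fun _ => mem_iUnion.2 hω⟩
  rw [h2] at h1
  exact h1

/-- Letting `u → ∞` in the renewal equation, by monotone convergence, identifies its constant term
`survival 0`. -/
theorem survival_zero_add (X : RiskModel Ω P) [IsProbabilityMeasure P] (hZ : Integrable (X.Z 0) P)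
    (hprofit : X.lam * X.moment 1 < X.c) :
    X.survival 0 + ENNReal.ofReal (X.lam / X.c) * ∫⁻ y in Ioi 0, X.tail y = 1 := by
  have hsm := X.survival_mono.measurable
  have hTm := X.tail_anti.measurable
  have hl := X.tendsto_survival hZ hprofit
  have hly : ∀ y : ℝ, Tendsto (fun N : ℕ => X.survival (N - y)) atTop (𝓝 1) := by
    intro y
    obtain ⟨M, hM⟩ := exists_nat_ge y
    refine tendsto_of_tendsto_of_tendsto_of_le_of_le' (hl.comp (tendsto_sub_atTop_nat M))
      tendsto_const_nhds ?_ (Eventually.of_forall fun N => X.survival_le_one _)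
    filter_upwards [eventually_ge_atTop M] with N hN
    apply X.survival_mono
    simp only [Nat.cast_sub hN]
    linarith
  have h1 : Tendsto (fun N : ℕ => ∫⁻ y in Ioi 0, X.survival (N - y) * X.tail y) atTop
      (𝓝 (∫⁻ y in Ioi 0, X.tail y)) := by
    refine lintegral_tendsto_of_tendsto_of_monotone
      (fun N => Measurable.aemeasurable (by fun_prop)) (ae_of_all _ fun y a b hab => ?_)
      (ae_of_all _ fun y => ?_)
    · have : (a : ℝ) ≤ b := by exact_mod_cast hab
      exact mul_le_mul_left (X.survival_mono (by linarith)) _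
    · simpa using ENNReal.Tendsto.mul_const (hly y) (b := X.tail y) (Or.inl one_ne_zero)
  have h2 : Tendsto (fun N : ℕ => X.survival N) atTop
      (𝓝 (X.survival 0 + ENNReal.ofReal (X.lam / X.c) * ∫⁻ y in Ioi 0, X.tail y)) := by
    simp_rw [fun N : ℕ => X.survival_renewal (Nat.cast_nonneg N)]
    exact tendsto_const_nhds.add (ENNReal.Tendsto.const_mul h1 (Or.inr ENNReal.ofReal_ne_top))
  exact tendsto_nhds_unique h2 hl

end RiskModel

/-! ### From the standing assumptions to tilted renewal data and the Lundberg expansion. -/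

namespace RiskModel

variable {Ω : Type*} [MeasurableSpace Ω] {P : Measure Ω}

theorem one_sub_F (X : RiskModel Ω P) [IsProbabilityMeasure P] (y : ℝ) :
    1 - X.F y = (X.tail y).toReal := by
  have hm : MeasurableSet {ω | X.Z 0 ω ≤ y} := measurableSet_le (X.measurable_Z 0) measurable_const
  rw [F, ← probReal_compl_eq_one_sub hm, tail, Measure.map_apply (X.measurable_Z 0) measurableSet_Ioi,
    measureReal_def]
  congr 2
  ext ω
  simp

theorem tail_le_one (X : RiskModel Ω P) [IsProbabilityMeasure P] (y : ℝ) : X.tail y ≤ 1 := by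
  have := Measure.isProbabilityMeasure_map (μ := P) (X.measurable_Z 0).aemeasurable
  exact prob_le_one

theorem ofReal_one_sub_F (X : RiskModel Ω P) [IsProbabilityMeasure P] (y : ℝ) :
    ENNReal.ofReal (1 - X.F y) = X.tail y := by
  rw [one_sub_F, ENNReal.ofReal_toReal (ne_top_of_le_ne_top ENNReal.one_ne_top (X.tail_le_one y))]

theorem one_sub_F_nonneg (X : RiskModel Ω P) [IsProbabilityMeasure P] (y : ℝ) : 0 ≤ 1 - X.F y := by
  rw [one_sub_F]; exact ENNReal.toReal_nonneg

theorem one_sub_F_pos (X : RiskModel Ω P) [IsProbabilityMeasure P] (y : ℝ) : 0 < 1 - X.F y := by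
  rw [one_sub_F]
  refine ENNReal.toReal_pos ?_ (ne_top_of_le_ne_top ENNReal.one_ne_top (X.tail_le_one y))
  rw [tail, Measure.map_apply (X.measurable_Z 0) measurableSet_Ioi]
  exact (X.unbounded_Z y).ne'

theorem measurable_one_sub_F (X : RiskModel Ω P) [IsProbabilityMeasure P] :
    Measurable fun y => 1 - X.F y := by
  simp_rw [X.one_sub_F]
  exact X.tail_anti.measurable.ennreal_toReal

theorem tail_eq (X : RiskModel Ω P) (y : ℝ) : X.tail y = P {ω | y < X.Z 0 ω} :=
  Measure.map_apply (X.measurable_Z 0) measurableSet_Ioi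

theorem moment_pos (X : RiskModel Ω P) {j : ℕ} (hj : Integrable (fun ω => X.Z 0 ω ^ j) P) :
    0 < X.moment j := by
  rw [moment, integral_pos_iff_support_of_nonneg_ae _ hj]
  · refine lt_of_lt_of_le (X.unbounded_Z 0) (measure_mono fun ω (hω : 0 < X.Z 0 ω) => ?_)
    exact (pow_pos hω j).ne'
  · filter_upwards [X.pos_Z 0] with ω hω using (pow_pos hω j).le

/-- The intensity-normalised tail of the claims, i.e. `f_I / (1 + θ)`. -/
noncomputable def ladder (X : RiskModel Ω P) (y : ℝ) : ℝ := X.lam / X.c * (1 - X.F y)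

theorem one_add_theta (X : RiskModel Ω P) :
    1 + X.theta = X.c / (X.lam * X.moment 1) := by
  rw [theta]; ring

/-- With `m₁ = 0`, division by zero makes `fI` vanish and its integral could not be `1`. As a
nonintegrable claim has `moment 1 = 0` by convention, integrability of `Z` follows as well. -/
theorem IsAdjustmentCoeff.moment_one_ne_zero {X : RiskModel Ω P} {R : ℝ}
    (h : X.IsAdjustmentCoeff R) : X.moment 1 ≠ 0 := by
  intro h0
  have := h.2.2
  simp [fI, h0] at this

theorem IsAdjustmentCoeff.integrable_Z {X : RiskModel Ω P} {R : ℝ}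
    (h : X.IsAdjustmentCoeff R) : Integrable (X.Z 0) P := by
  by_contra hi
  apply h.moment_one_ne_zero
  simp only [moment, pow_one]
  exact integral_undef hi

theorem IsAdjustmentCoeff.moment_one_pos {X : RiskModel Ω P} {R : ℝ}
    (h : X.IsAdjustmentCoeff R) : 0 < X.moment 1 :=
  X.moment_pos (by simpa using h.integrable_Z)

theorem IsAdjustmentCoeff.fI_div {X : RiskModel Ω P} {R : ℝ}
    (h : X.IsAdjustmentCoeff R) (y : ℝ) :
    X.fI y / (1 + X.theta) = X.ladder y := by
  have h1 := h.moment_one_pos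
  have h2 := X.lam_pos
  have h3 := X.c_pos
  rw [X.one_add_theta, fI, ladder]
  field_simp

theorem IsAdjustmentCoeff.integrable_exp_ladder {X : RiskModel Ω P} {R : ℝ}
    (h : X.IsAdjustmentCoeff R) :
    IntegrableOn (fun y => Real.exp (R * y) * X.ladder y) (Ioi 0) := by
  have := h.2.1
  simp_rw [h.fI_div] at this
  exact this

theorem IsAdjustmentCoeff.integral_exp_ladder {X : RiskModel Ω P} {R : ℝ}
    (h : X.IsAdjustmentCoeff R) :
    ∫ y in Ioi 0, Real.exp (R * y) * X.ladder y = 1 := by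
  have := h.2.2
  simp_rw [h.fI_div] at this
  exact this

section Assumptions

variable {X : RiskModel Ω P} [IsProbabilityMeasure P] {k : ℕ} {R : ℝ}

theorem ladder_nonneg (X : RiskModel Ω P) (y : ℝ) : 0 ≤ X.ladder y :=
  mul_nonneg (div_pos X.lam_pos X.c_pos).le (X.one_sub_F_nonneg y)

theorem measurable_ladder (X : RiskModel Ω P) : Measurable X.ladder :=
  X.measurable_one_sub_F.const_mul _

theorem IsAdjustmentCoeff.integrable_pow_ladder (h : X.IsAdjustmentCoeff R) (j : ℕ) :
    IntegrableOn (fun y => y ^ j * X.ladder y) (Ioi 0) := by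
  have hR := h.1
  have hm := X.measurable_ladder
  refine (h.integrable_exp_ladder.const_mul (j.factorial / R ^ j)).mono'
    (by fun_prop) ?_
  filter_upwards [self_mem_ae_restrict measurableSet_Ioi] with y hy
  have hy : 0 < y := hy
  have hl := X.ladder_nonneg y
  rw [Real.norm_of_nonneg (by positivity), ← mul_assoc]
  gcongr
  have := Real.pow_div_factorial_le_exp (R * y) (by positivity) j
  rw [div_le_iff₀ (by positivity), mul_pow] at this
  rw [div_mul_eq_mul_div, le_div_iff₀ (by positivity)]
  linarith

theorem IsAdjustmentCoeff.integrable_pow_tail (h : X.IsAdjustmentCoeff R) (j : ℕ) :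
    IntegrableOn (fun y => y ^ j * (1 - X.F y)) (Ioi 0) := by
  have h1 := X.lam_pos
  have h2 := X.c_pos
  refine ((h.integrable_pow_ladder j).const_mul (X.c / X.lam)).congr (ae_of_all _ fun y => ?_)
  simp only [ladder]
  field_simp

theorem lintegral_pow_Z (X : RiskModel Ω P) (j : ℕ) :
    ∫⁻ ω, ENNReal.ofReal (X.Z 0 ω ^ (j + 1)) ∂P
      = ∫⁻ y in Ioi 0, ENNReal.ofReal ((j + 1) * (y ^ j * (1 - X.F y))) := by
  have h := lintegral_comp_eq_lintegral_meas_lt_mul P (f := X.Z 0) (g := fun t => (j + 1) * t ^ j)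
    (by filter_upwards [X.pos_Z 0] with ω hω using hω.le) (X.measurable_Z 0).aemeasurable
    (fun t _ => Continuous.intervalIntegrable (by fun_prop) _ _) (by
      filter_upwards [self_mem_ae_restrict measurableSet_Ioi] with y hy
      have hy : 0 < y := hy
      positivity)
  have hint : ∀ z : ℝ, ∫ t in (0 : ℝ)..z, ((j : ℝ) + 1) * t ^ j = z ^ (j + 1) := by
    intro z
    rw [intervalIntegral.integral_const_mul, integral_pow]
    field_simp
    simp
  simp_rw [hint] at h
  rw [h]
  refine setLIntegral_congr_fun measurableSet_Ioi fun y hy => ?_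
  have hy : 0 < y := hy
  rw [← X.tail_eq, ← X.ofReal_one_sub_F, ← ENNReal.ofReal_mul (X.one_sub_F_nonneg y)]
  congr 1
  ring

theorem IsAdjustmentCoeff.integrable_pow_Z (h : X.IsAdjustmentCoeff R) (j : ℕ) :
    Integrable (fun ω => X.Z 0 ω ^ j) P := by
  rcases j with _ | j
  · simp
  · have hm := X.measurable_Z 0
    refine ⟨by fun_prop, ?_⟩
    rw [hasFiniteIntegral_iff_ofReal
      (by filter_upwards [X.pos_Z 0] with ω hω using (pow_pos hω _).le), lintegral_pow_Z]
    exact (((h.integrable_pow_tail j).const_mul ((j : ℝ) + 1))).lintegral_lt_top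

theorem moment_succ (X : RiskModel Ω P) (j : ℕ) :
    X.moment (j + 1) = (j + 1) * ∫ y in Ioi 0, y ^ j * (1 - X.F y) := by
  have hm := X.measurable_Z 0
  have hm' := X.measurable_one_sub_F
  rw [moment, integral_eq_lintegral_of_nonneg_ae
    (by filter_upwards [X.pos_Z 0] with ω hω using (pow_pos hω _).le) (by fun_prop),
    lintegral_pow_Z, ← integral_const_mul, integral_eq_lintegral_of_nonneg_ae _ (by fun_prop)]
  filter_upwards [self_mem_ae_restrict measurableSet_Ioi] with y hy
  have hy : 0 < y := hy
  have := X.one_sub_F_nonneg y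
  simp only [Pi.zero_apply]
  positivity

theorem integral_pow_ladder (X : RiskModel Ω P) (j : ℕ) :
    ∫ y in Ioi 0, y ^ j * X.ladder y = X.lam / X.c * X.moment (j + 1) / (j + 1) := by
  rw [X.moment_succ]
  have : ∀ y, y ^ j * X.ladder y = X.lam / X.c * (y ^ j * (1 - X.F y)) := fun y => by
    rw [ladder]; ring
  simp_rw [this]
  rw [integral_const_mul]
  field_simp

/-- The layer-cake formula writes `E[e^{RZ} - 1]` as `R ∫ e^{Ry} P(Z > y) dy`. Finiteness of the
moment generating function at `R` later controls sums of many claims. -/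
theorem IsAdjustmentCoeff.integrable_exp_Z (h : X.IsAdjustmentCoeff R) :
    Integrable (fun ω => Real.exp (R * X.Z 0 ω)) P := by
  have hR := h.1
  have hm := X.measurable_Z 0
  have hl := lintegral_comp_eq_lintegral_meas_lt_mul P (f := X.Z 0)
    (g := fun t => R * Real.exp (R * t))
    (by filter_upwards [X.pos_Z 0] with ω hω using hω.le) (X.measurable_Z 0).aemeasurable
    (fun t _ => Continuous.intervalIntegrable (by fun_prop) _ _) (ae_of_all _ fun y => by positivity)
  have hint : ∀ z : ℝ, ∫ t in (0 : ℝ)..z, R * Real.exp (R * t) = Real.exp (R * z) - 1 := by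
    intro z
    have hd : ∀ t ∈ uIcc 0 z, HasDerivAt (fun t => Real.exp (R * t)) (R * Real.exp (R * t)) t := by
      intro t _
      have := ((hasDerivAt_id t).const_mul R).exp
      simpa [mul_comm] using this
    rw [intervalIntegral.integral_eq_sub_of_hasDerivAt hd
      (Continuous.intervalIntegrable (by fun_prop) _ _)]
    simp
  simp_rw [hint] at hl
  have hfin : ∫⁻ ω, ENNReal.ofReal (Real.exp (R * X.Z 0 ω) - 1) ∂P < ∞ := by
    rw [hl]
    have hi := (h.integrable_exp_ladder.const_mul (R * (X.c / X.lam))).lintegral_lt_top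
    refine lt_of_le_of_lt (le_of_eq (lintegral_congr fun y => ?_)) hi
    have h1 := X.lam_pos
    have h2 := X.c_pos
    rw [← X.tail_eq, ← X.ofReal_one_sub_F, ← ENNReal.ofReal_mul (X.one_sub_F_nonneg y)]
    congr 1
    rw [ladder]
    field_simp
  have hi : Integrable (fun ω => Real.exp (R * X.Z 0 ω) - 1) P := by
    refine ⟨by fun_prop, ?_⟩
    rwa [hasFiniteIntegral_iff_ofReal]
    filter_upwards [X.pos_Z 0] with ω hω
    simp only [Pi.zero_apply, sub_nonneg]
    exact Real.one_le_exp (by positivity)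
  exact (hi.add (integrable_const 1)).congr (ae_of_all _ fun ω => by simp)

/-- The net profit condition follows from the existence of an adjustment coefficient. -/
theorem IsAdjustmentCoeff.net_profit (h : X.IsAdjustmentCoeff R) : X.lam * X.moment 1 < X.c := by
  have hR := h.1
  have hl := X.lam_pos
  have hc := X.c_pos
  have hm2 := X.moment_pos (h.integrable_pow_Z 2)
  have h0 := h.integrable_pow_ladder 0
  have h1 := h.integrable_pow_ladder 1
  -- This is `1 + R y ≤ e^{Ry}` integrated against `ladder`; the second summand is strictly
  -- positive.
  have : X.lam / X.c * X.moment 1 + R * (X.lam / X.c * X.moment 2 / 2) ≤ 1 := by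
    have e0 := X.integral_pow_ladder 0
    have e1 := X.integral_pow_ladder 1
    norm_num at e0 e1
    simp only [pow_zero, pow_one, one_mul] at h0 h1
    rw [← e0, ← e1, ← integral_const_mul, ← integral_add h0 (h1.const_mul R),
      ← h.integral_exp_ladder]
    refine setIntegral_mono_on (h0.add (h1.const_mul R)) h.integrable_exp_ladder measurableSet_Ioi
      fun y hy => ?_
    have := Real.add_one_le_exp (R * y)
    nlinarith [X.ladder_nonneg y]
  have h3 : X.lam / X.c * X.moment 1 < 1 := by
    have : 0 < R * (X.lam / X.c * X.moment 2 / 2) := by positivity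
    linarith
  rw [div_mul_eq_mul_div, div_lt_one hc] at h3
  exact h3

theorem Assumptions.hI_nonneg (h : X.Assumptions k R) : 0 ≤ X.hI := by
  have h1 : X.fI 0 / (1 - X.FI 0) ≤ X.hI := le_csSup h.2.2 ⟨0, mem_Ici.2 le_rfl, rfl⟩
  refine le_trans ?_ h1
  simp only [FI, intervalIntegral.integral_same, mul_zero, sub_zero, div_one, fI]
  exact div_nonneg (X.one_sub_F_nonneg 0) h.1.moment_one_pos.le

theorem Assumptions.hazard_ladder (h : X.Assumptions k R) {y : ℝ} (hy : 0 ≤ y) :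
    X.ladder y ≤ X.hI * ∫ z in Ioi y, X.ladder z := by
  have hm1 := h.1.moment_one_pos
  have hi : IntegrableOn (fun y => 1 - X.F y) (Ioi 0) := by
    simpa using h.1.integrable_pow_tail 0
  have hiy := hi.mono_set (Ioi_subset_Ioi hy)
  have h1 : X.fI y / (1 - X.FI y) ≤ X.hI := le_csSup h.2.2 ⟨y, hy, rfl⟩
  have e0 : X.moment 1 = ∫ y in Ioi 0, (1 - X.F y) := by simpa using X.moment_succ 0
  -- Unbounded support keeps the denominator of the hazard rate positive, so the quotient is not a
  -- default value.
  have hpos : 0 < ∫ z in Ioi y, (1 - X.F z) := by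
    rw [setIntegral_pos_iff_support_of_nonneg_ae (ae_of_all _ fun z => X.one_sub_F_nonneg z) hiy]
    have : Function.support (fun z => 1 - X.F z) = univ :=
      eq_univ_of_forall fun z => (X.one_sub_F_pos z).ne'
    rw [this, univ_inter, Real.volume_Ioi]
    exact ENNReal.coe_lt_top
  have hFI : 1 - X.FI y = (∫ z in Ioi y, (1 - X.F z)) / X.moment 1 := by
    have hsplit : X.moment 1 = (∫ z in (0 : ℝ)..y, (1 - X.F z)) + ∫ z in Ioi y, (1 - X.F z) := by
      rw [e0, intervalIntegral.integral_of_le hy, ← setIntegral_union (Ioc_disjoint_Ioi le_rfl)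
        measurableSet_Ioi (hi.mono_set Ioc_subset_Ioi_self) hiy, Ioc_union_Ioi_eq_Ioi hy]
    rw [FI]
    field_simp
    linarith
  rw [hFI, fI, div_div_div_cancel_right₀ hm1.ne', div_le_iff₀ hpos] at h1
  simp only [ladder]
  rw [integral_const_mul, mul_left_comm]
  exact mul_le_mul_of_nonneg_left h1 (div_pos X.lam_pos X.c_pos).le

/-- The renewal equation for `ψ` is `survival_zero_add` minus `survival_renewal`: the constants
cancel, and since survival is `0` at negative reserves, the part `y > u` of the integral enters with
`ψ = 1`. -/
theorem Assumptions.tiltedRenewal (h : X.Assumptions k R) (hk : 2 ≤ k) {K H : ℝ}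
    (hK : X.expMoment k R ≤ K) (hH : X.hI ≤ H) :
    TiltedRenewal X.ruinProb X.ladder k R K H where
  measurable_sol := by
    simp_rw [funext X.ruinProb_eq]
    exact measurable_const.sub X.survival_mono.measurable.ennreal_toReal
  sol_nonneg u := measureReal_nonneg
  sol_le_one u := measureReal_le_one
  sol_neg u hu := by simp [X.ruinProb_eq, X.survival_of_neg hu]
  measurable_step := X.measurable_ladder
  step_nonneg := X.ladder_nonneg
  renewal u hu := by
    have hq : 0 < X.lam / X.c := div_pos X.lam_pos X.c_pos
    have hsm := X.survival_mono.measurable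
    have hTm := X.tail_anti.measurable
    have h0 : IntegrableOn X.ladder (Ioi 0) := by simpa using h.1.integrable_pow_ladder 0
    have hst : ∀ v, X.survival v ≠ ∞ := fun v =>
      ne_top_of_le_ne_top ENNReal.one_ne_top (X.survival_le_one v)
    have hs1 : ∀ v, (X.survival v).toReal ≤ 1 := fun v =>
      ENNReal.toReal_le_of_le_ofReal zero_le_one (by simpa using X.survival_le_one v)
    have htt : ∀ v, X.tail v ≠ ∞ := fun v =>
      ne_top_of_le_ne_top ENNReal.one_ne_top (X.tail_le_one v)
    have hlad : ∀ y, X.ladder y = (ENNReal.ofReal (X.lam / X.c) * X.tail y).toReal := fun y => by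
      rw [ladder, one_sub_F, ENNReal.toReal_mul, ENNReal.toReal_ofReal hq.le]
    have h1 : 1 = (X.survival 0).toReal + ∫ y in Ioi 0, X.ladder y := by
      have e := congrArg ENNReal.toReal (X.survival_zero_add h.1.integrable_Z h.1.net_profit)
      rw [← lintegral_const_mul _ hTm] at e
      rw [ENNReal.toReal_add (hst 0) (ne_top_of_le_ne_top ENNReal.one_ne_top (by
        rw [lintegral_const_mul _ hTm, ← X.survival_zero_add h.1.integrable_Z h.1.net_profit]
        exact le_add_self))] at e
      simp_rw [hlad]
      rw [integral_toReal (by fun_prop) (ae_of_all _ fun y =>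
        ENNReal.mul_lt_top ENNReal.ofReal_lt_top (htt y).lt_top), e, ENNReal.toReal_one]
    have hsi : IntegrableOn (fun y => (X.survival (u - y)).toReal * X.ladder y) (Ioi 0) := by
      have hlm := X.measurable_ladder
      refine h0.mono' (by fun_prop) (ae_of_all _ fun y => ?_)
      rw [norm_mul, Real.norm_of_nonneg ENNReal.toReal_nonneg,
        Real.norm_of_nonneg (X.ladder_nonneg y)]
      exact mul_le_of_le_one_left (X.ladder_nonneg y) (hs1 _)
    have h2 : (X.survival u).toReal = (X.survival 0).toReal
        + ∫ y in Ioi 0, (X.survival (u - y)).toReal * X.ladder y := by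
      have hle := X.survival_renewal hu
      have e := congrArg ENNReal.toReal hle
      rw [← lintegral_const_mul _ (by fun_prop)] at e hle
      rw [e, ENNReal.toReal_add (hst 0) (ne_top_of_le_ne_top (hst u) (hle ▸ le_add_self))]
      simp_rw [hlad, ← ENNReal.toReal_mul]
      rw [integral_toReal (by fun_prop) (ae_of_all _ fun y => ENNReal.mul_lt_top
        (hst _).lt_top (ENNReal.mul_lt_top ENNReal.ofReal_lt_top (htt y).lt_top))]
      congr 3
      funext y
      ring
    simp_rw [X.ruinProb_eq, sub_mul, one_mul]
    rw [integral_sub h0 hsi]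
    linarith
  two_le := hk
  pos := h.1.1
  integrable_tilt := h.1.integrable_exp_ladder
  integral_tilt := h.1.integral_exp_ladder
  integrable_moment := by
    have := h.2.1
    simp only [HasExpMoment, h.1.fI_div] at this
    exact this
  moment_le := by
    simp only [expMoment, h.1.fI_div] at hK
    exact hK
  hazard_nonneg := h.hI_nonneg.trans hH
  hazard y hy := by
    refine (h.hazard_ladder hy).trans ?_
    gcongr
    exact setIntegral_nonneg measurableSet_Ioi fun z _ => X.ladder_nonneg z

/-- Expansion of the Cramér-Lundberg equation in powers of the adjustment coefficient. -/
theorem Assumptions.lundberg_expansion (h : X.Assumptions k R) (hk : 2 ≤ k) {K : ℝ}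
    (hK : X.expMoment k R ≤ K) {n : ℕ} (hn : n ≤ k) :
    0 ≤ X.c - ∑ j ∈ Finset.range n, X.lam * X.moment (j + 1) / (j + 1).factorial * R ^ j ∧
    X.c - ∑ j ∈ Finset.range n, X.lam * X.moment (j + 1) / (j + 1).factorial * R ^ j
      ≤ X.c * (R ^ n * (1 + K)) := by
  have hR := h.1.1
  have hc := X.c_pos
  have htr := h.tiltedRenewal hk hK le_rfl
  -- The sum is `c` times the integral of the Taylor polynomial of `e^{Ry}` against `ladder`. As `c
  -- = c ∫ e^{Ry} ladder`, the difference in the statement is the integrated Taylor remainder, which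
  -- lies between `0` and `(R y)ⁿ e^{Ry}` pointwise.
  have hsum : ∑ j ∈ Finset.range n, X.lam * X.moment (j + 1) / (j + 1).factorial * R ^ j
      = X.c * ∫ y in Ioi 0, (∑ j ∈ Finset.range n, (R * y) ^ j / j.factorial) * X.ladder y := by
    simp_rw [Finset.sum_mul]
    rw [integral_finsetSum _ fun j _ => ?_, Finset.mul_sum]
    · refine Finset.sum_congr rfl fun j _ => ?_
      have : ∀ y, (R * y) ^ j / j.factorial * X.ladder y
          = R ^ j / j.factorial * (y ^ j * X.ladder y) := fun y => by rw [mul_pow]; ring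
      simp_rw [this]
      rw [integral_const_mul, X.integral_pow_ladder, Nat.factorial_succ]
      push_cast
      field_simp
    · refine ((h.1.integrable_pow_ladder j).const_mul (R ^ j / j.factorial)).congr
        (ae_of_all _ fun y => ?_)
      simp only [mul_pow]
      ring
  have hi : IntegrableOn (fun y => (∑ j ∈ Finset.range n, (R * y) ^ j / j.factorial) * X.ladder y)
      (Ioi 0) := by
    simp_rw [Finset.sum_mul]
    refine integrable_finsetSum _ fun j _ => ?_
    refine ((h.1.integrable_pow_ladder j).const_mul (R ^ j / j.factorial)).congr
      (ae_of_all _ fun y => ?_)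
    simp only [mul_pow]
    ring
  have hdiff : X.c - ∑ j ∈ Finset.range n, X.lam * X.moment (j + 1) / (j + 1).factorial * R ^ j
      = X.c * ∫ y in Ioi 0, (Real.exp (R * y)
        - ∑ j ∈ Finset.range n, (R * y) ^ j / j.factorial) * X.ladder y := by
    simp_rw [sub_mul]
    rw [hsum, integral_sub h.1.integrable_exp_ladder hi, h.1.integral_exp_ladder]
    ring
  rw [hdiff]
  constructor
  · refine mul_nonneg hc.le (setIntegral_nonneg measurableSet_Ioi fun y hy => ?_)
    have hy : 0 < y := hy
    exact mul_nonneg (sub_nonneg.2 (Real.sum_le_exp_of_nonneg (by positivity) n)) (X.ladder_nonneg y)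
  · refine mul_le_mul_of_nonneg_left ?_ hc.le
    have hb := htr.integrable_tilt.add htr.integrable_moment
    have hb1 : R ^ n * ∫ y in Ioi 0, (Real.exp (R * y) * X.ladder y
        + y ^ k * Real.exp (R * y) * X.ladder y) ≤ R ^ n * (1 + K) := by
      refine mul_le_mul_of_nonneg_left ?_ (by positivity)
      rw [integral_add htr.integrable_tilt htr.integrable_moment, htr.integral_tilt]
      linarith [htr.moment_le]
    refine le_trans ?_ hb1
    rw [← integral_const_mul]
    refine setIntegral_mono_on ?_ (hb.const_mul _) measurableSet_Ioi fun y hy => ?_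
    · have := h.1.integrable_exp_ladder.sub hi
      refine this.congr (ae_of_all _ fun y => ?_)
      simp [sub_mul]
    have hy : 0 < y := hy
    have hl := X.ladder_nonneg y
    have h1 : Real.exp (R * y) - ∑ j ∈ Finset.range n, (R * y) ^ j / j.factorial
        ≤ (R * y) ^ n * Real.exp (R * y) := by
      have := Complex.norm_exp_sub_sum_le_norm_mul_exp ((R * y : ℝ) : ℂ) n
      rw [Complex.norm_real, Real.norm_of_nonneg (by positivity : 0 ≤ R * y)] at this
      refine le_trans ?_ this
      refine le_trans (le_abs_self _) (le_of_eq ?_)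
      rw [← Real.norm_eq_abs, ← Complex.norm_real]
      push_cast
      rfl
    have h2 : y ^ n ≤ 1 + y ^ k := by
      rcases le_total y 1 with h1 | h1
      · have := pow_le_one₀ hy.le h1 (n := n)
        have : 0 ≤ y ^ k := by positivity
        linarith
      · have := pow_le_pow_right₀ h1 hn
        linarith
    calc _ ≤ (R * y) ^ n * Real.exp (R * y) * X.ladder y := by gcongr
      _ = R ^ n * y ^ n * Real.exp (R * y) * X.ladder y := by rw [mul_pow]
      _ ≤ R ^ n * (1 + y ^ k) * Real.exp (R * y) * X.ladder y := by gcongr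
      _ = _ := by ring

end Assumptions

end RiskModel

/-! ### Moments of the reserve at small times. -/

namespace RiskModel

variable {Ω : Type*} [MeasurableSpace Ω] {P : Measure Ω}

/-- The event that exactly `n` claims arrive until time `t`, up to a null set. -/
def countEvent (X : RiskModel Ω P) (t : ℝ) (n : ℕ) : Set Ω :=
  {ω | X.arrival n ω ≤ t ∧ t < X.arrival (n + 1) ω}

theorem measurableSet_countEvent (X : RiskModel Ω P) (t : ℝ) (n : ℕ) :
    MeasurableSet (X.countEvent t n) :=
  (measurableSet_le (X.measurable_arrival n) measurable_const).inter
    (measurableSet_lt measurable_const (X.measurable_arrival (n + 1)))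

/-- The sum of the first `n` claims. -/
def claimSum (X : RiskModel Ω P) (n : ℕ) (ω : Ω) : ℝ := ∑ i ∈ Finset.range n, X.Z i ω

theorem measurable_claimSum (X : RiskModel Ω P) (n : ℕ) : Measurable (X.claimSum n) := by
  have := X.measurable_Z
  unfold claimSum
  fun_prop

/-- The event depends on the waiting times alone and `claimSum` on the claims alone, so independence
factorises the integral. -/
theorem integral_countEvent_claimSum (X : RiskModel Ω P) (t : ℝ) (n : ℕ) {g : ℝ → ℝ}
    (hg : Measurable g) :
    ∫ ω, (X.countEvent t n).indicator (fun ω => g (X.claimSum n ω)) ω ∂P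
      = P.real (X.countEvent t n) * ∫ ω, g (X.claimSum n ω) ∂P := by
  have hind := iIndepFun_indepFun_of_disjoint_range (f := X.driver) X.indep X.measurable_driver
    (Sum.inl : ℕ → ℕ ⊕ ℕ) (Sum.inr : ℕ → ℕ ⊕ ℕ) (by
      rw [Set.disjoint_left]
      rintro _ ⟨b, rfl⟩ ⟨i, hi⟩
      simp at hi)
  set B : Set (ℕ → ℝ) := {w | ∑ i ∈ Finset.range n, w i ≤ t ∧ t < ∑ i ∈ Finset.range (n + 1), w i}
    with hB
  have hsm : ∀ m, Measurable fun z : ℕ → ℝ => ∑ i ∈ Finset.range m, z i := fun m => by fun_prop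
  have hBm : MeasurableSet B :=
    (measurableSet_le (hsm n) measurable_const).inter (measurableSet_lt measurable_const (hsm (n + 1)))
  have hgm : Measurable fun z : ℕ → ℝ => g (∑ i ∈ Finset.range n, z i) := hg.comp (hsm n)
  have h := hind.integral_fun_comp_mul_comp (f := B.indicator (fun _ => (1 : ℝ)))
    (g := fun z : ℕ → ℝ => g (∑ i ∈ Finset.range n, z i))
    (measurable_pi_lambda _ fun i => X.measurable_driver _).aemeasurable
    (measurable_pi_lambda _ fun i => X.measurable_driver _).aemeasurable
    (measurable_const.indicator hBm).aestronglyMeasurable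
    hgm.aestronglyMeasurable
  have h1 : ∀ ω, B.indicator (fun _ => (1 : ℝ)) (fun i => X.driver (Sum.inl i) ω)
      = (X.countEvent t n).indicator (fun _ => 1) ω := fun ω => rfl
  simp_rw [h1] at h
  rw [integral_indicator_const _ (X.measurableSet_countEvent t n), smul_eq_mul, mul_one] at h
  rw [← show _ = P.real (X.countEvent t n) * ∫ ω, g (X.claimSum n ω) ∂P from h]
  refine integral_congr_ae (ae_of_all _ fun ω => ?_)
  by_cases hω : ω ∈ X.countEvent t n
  · simp only [indicator_of_mem hω, one_mul]; rfl
  · simp [indicator_of_notMem hω]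

theorem ae_Z_pos (X : RiskModel Ω P) : ∀ᵐ ω ∂P, ∀ i, 0 < X.Z i ω := ae_all_iff.2 X.pos_Z

theorem identDistrib_Z (X : RiskModel Ω P) (i : ℕ) : IdentDistrib (X.Z i) (X.Z 0) P P :=
  ⟨(X.measurable_Z i).aemeasurable, (X.measurable_Z 0).aemeasurable, X.ident_Z i⟩

theorem integral_exp_claimSum (X : RiskModel Ω P) (R : ℝ) (n : ℕ) :
    ∫ ω, Real.exp (R * X.claimSum n ω) ∂P = mgf (X.Z 0) P R ^ n := by
  have hi : iIndepFun X.Z P := X.indep.precomp (g := Sum.inr) Sum.inr_injective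
  have h := hi.mgf_sum (t := R) X.measurable_Z (Finset.range n)
  rw [Finset.prod_congr rfl fun i _ => mgf_congr_of_identDistrib _ _ (X.identDistrib_Z i) R,
    Finset.prod_const, Finset.card_range] at h
  rw [← h, mgf]
  simp [claimSum]

theorem measureReal_countEvent_le (X : RiskModel Ω P) (n : ℕ) {t : ℝ}
    (ht : 0 ≤ t) : P.real (X.countEvent t n) ≤ (X.lam * t) ^ n := by
  have hl := X.lam_pos
  have h1 : 0 ≤ 1 - Real.exp (-(X.lam * t)) := by
    rw [sub_nonneg, Real.exp_le_one_iff]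
    nlinarith
  have h2 : P.real (X.countEvent t n) ≤ (1 - Real.exp (-(X.lam * t))) ^ n := by
    refine ENNReal.toReal_le_of_le_ofReal (by positivity) ?_
    rw [ENNReal.ofReal_pow h1]
    exact (measure_mono fun ω hω => hω.1).trans (X.measure_arrival_le n ht)
  refine h2.trans (pow_le_pow_left₀ h1 ?_ n)
  linarith [Real.add_one_le_exp (-(X.lam * t))]

theorem measureReal_countEvent_zero (X : RiskModel Ω P) {t : ℝ}
    (ht : 0 ≤ t) : P.real (X.countEvent t 0) = Real.exp (-(X.lam * t)) := by
  have : X.countEvent t 0 = {ω | t < X.W 0 ω} := by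
    ext ω
    simp [countEvent, arrival, ht]
  rw [this, measureReal_def, X.measure_lt_W 0 ht, ENNReal.toReal_ofReal (Real.exp_pos _).le]

section Moments

variable {X : RiskModel Ω P} [IsProbabilityMeasure P] {R : ℝ}

theorem IsAdjustmentCoeff.integrable_exp_claimSum (h : X.IsAdjustmentCoeff R) (n : ℕ) :
    Integrable (fun ω => Real.exp (R * X.claimSum n ω)) P := by
  have hi : iIndepFun X.Z P := X.indep.precomp (g := Sum.inr) Sum.inr_injective
  have := hi.integrable_exp_mul_sum (t := R) X.measurable_Z (s := Finset.range n) fun i _ =>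
    ((X.identDistrib_Z i).comp (u := fun z => Real.exp (R * z)) (by fun_prop)).integrable_iff.2
      h.integrable_exp_Z
  refine this.congr (ae_of_all _ fun ω => ?_)
  simp [claimSum]

/-- A domination independent of `t ∈ [0, 1]`: it serves both for dominated convergence as `t → 0`
and for the geometric series over the number of claims. -/
theorem pow_abs_sub_le {R c t s : ℝ} (hR : 0 < R) (hc : 0 < c) (ht : 0 ≤ t) (ht1 : t ≤ 1)
    (hs : 0 ≤ s) (j : ℕ) :
    |(c * t - s) ^ j| ≤ j.factorial / R ^ j * Real.exp (R * c) * Real.exp (R * s) := by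
  have h1 : |c * t - s| ≤ c + s := by
    rw [abs_le]
    constructor <;> nlinarith
  rw [abs_pow]
  refine (pow_le_pow_left₀ (abs_nonneg _) h1 j).trans ?_
  have := Real.pow_div_factorial_le_exp (R * (c + s)) (by positivity) j
  rw [div_le_iff₀ (by positivity), mul_pow] at this
  rw [mul_assoc, ← Real.exp_add, ← mul_add, div_mul_eq_mul_div, le_div_iff₀ (by positivity)]
  linarith

/-- The contribution of the event of `n` claims to a moment of the reserve. -/
noncomputable def momentPart (X : RiskModel Ω P) (j : ℕ) (t : ℝ) (n : ℕ) : ℝ :=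
  P.real (X.countEvent t n) * ∫ ω, (X.c * t - X.claimSum n ω) ^ j ∂P

theorem IsAdjustmentCoeff.integrable_pow_sub (h : X.IsAdjustmentCoeff R) (j : ℕ) {t : ℝ}
    (ht : 0 ≤ t) (ht1 : t ≤ 1) (n : ℕ) :
    Integrable (fun ω => (X.c * t - X.claimSum n ω) ^ j) P := by
  have hm := X.measurable_claimSum n
  refine ((h.integrable_exp_claimSum n).const_mul
    (j.factorial / R ^ j * Real.exp (R * X.c))).mono' (by fun_prop) ?_
  filter_upwards [X.ae_Z_pos] with ω hω
  exact pow_abs_sub_le h.1 X.c_pos ht ht1 (Finset.sum_nonneg fun i _ => (hω i).le) j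

theorem IsAdjustmentCoeff.integral_norm_countEvent_le (h : X.IsAdjustmentCoeff R) (j : ℕ) {t : ℝ}
    (ht : 0 ≤ t) (ht1 : t ≤ 1) (n : ℕ) :
    ∫ ω, ‖(X.countEvent t n).indicator (fun ω => (X.c * t - X.claimSum n ω) ^ j) ω‖ ∂P
      ≤ j.factorial / R ^ j * Real.exp (R * X.c) * (X.lam * t * mgf (X.Z 0) P R) ^ n := by
  have hR := h.1
  have hl := X.lam_pos
  simp_rw [norm_indicator_eq_indicator_norm]
  rw [X.integral_countEvent_claimSum t n (g := fun s => ‖(X.c * t - s) ^ j‖) (by fun_prop)]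
  have h1 : ∫ ω, ‖(X.c * t - X.claimSum n ω) ^ j‖ ∂P
      ≤ j.factorial / R ^ j * Real.exp (R * X.c) * mgf (X.Z 0) P R ^ n := by
    rw [← X.integral_exp_claimSum, ← integral_const_mul]
    refine integral_mono_ae (h.integrable_pow_sub j ht ht1 n).norm
      ((h.integrable_exp_claimSum n).const_mul _) ?_
    filter_upwards [X.ae_Z_pos] with ω hω
    exact pow_abs_sub_le h.1 X.c_pos ht ht1 (Finset.sum_nonneg fun i _ => (hω i).le) j
  calc _ ≤ (X.lam * t) ^ n * (j.factorial / R ^ j * Real.exp (R * X.c) * mgf (X.Z 0) P R ^ n) := by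
        exact mul_le_mul (X.measureReal_countEvent_le n ht) h1
          (integral_nonneg fun ω => norm_nonneg _) (by positivity)
    _ = _ := by rw [mul_pow (X.lam * t)]; ring

theorem IsAdjustmentCoeff.hasSum_momentPart (h : X.IsAdjustmentCoeff R) (j : ℕ) {t : ℝ}
    (ht : 0 ≤ t) (ht1 : t ≤ 1) (hsmall : X.lam * t * mgf (X.Z 0) P R < 1) :
    HasSum (X.momentPart j t) (∫ ω, X.reserve 0 t ω ^ j ∂P) := by
  have hl := X.lam_pos
  have hM : 0 ≤ mgf (X.Z 0) P R := mgf_nonneg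
  have hsum : Summable fun n => ∫ ω, ‖(X.countEvent t n).indicator
      (fun ω => (X.c * t - X.claimSum n ω) ^ j) ω‖ ∂P := by
    refine Summable.of_nonneg_of_le (fun n => integral_nonneg fun ω => norm_nonneg _)
      (fun n => h.integral_norm_countEvent_le j ht ht1 n) ?_
    exact (summable_geometric_of_lt_one (by positivity) hsmall).mul_left _
  have hs := hasSum_integral_of_summable_integral_norm
    (fun n => (h.integrable_pow_sub j ht ht1 n).indicator (X.measurableSet_countEvent t n)) hsum
  have he : ∀ n, ∫ ω, (X.countEvent t n).indicator (fun ω => (X.c * t - X.claimSum n ω) ^ j) ω ∂P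
      = X.momentPart j t n := fun n =>
    X.integral_countEvent_claimSum t n (g := fun s => (X.c * t - s) ^ j) (by fun_prop)
  simp_rw [he] at hs
  suffices heq : ∫ ω, X.reserve 0 t ω ^ j ∂P = ∫ ω, ∑' n, (X.countEvent t n).indicator
      (fun ω => (X.c * t - X.claimSum n ω) ^ j) ω ∂P by rwa [heq]
  refine integral_congr_ae ?_
  filter_upwards [X.ae_regular] with ω hω
  obtain ⟨n, hn⟩ := hω.exists_arrival ht
  rw [tsum_eq_single n]
  · have : ω ∈ X.countEvent t n := hn
    rw [indicator_of_mem this, reserve, hω.count_eq hn.1 hn.2, zero_add]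
    rfl
  · intro m hm
    have : ω ∉ X.countEvent t m := fun hmem => hm (by
      rw [← hω.count_eq hmem.1 hmem.2, hω.count_eq hn.1 hn.2])
    exact indicator_of_notMem this _

theorem IsAdjustmentCoeff.abs_momentPart_le (h : X.IsAdjustmentCoeff R) (j : ℕ) {t : ℝ}
    (ht : 0 ≤ t) (ht1 : t ≤ 1) (n : ℕ) :
    |X.momentPart j t n|
      ≤ j.factorial / R ^ j * Real.exp (R * X.c) * (X.lam * t * mgf (X.Z 0) P R) ^ n := by
  refine le_trans ?_ (h.integral_norm_countEvent_le j ht ht1 n)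
  rw [momentPart, ← X.integral_countEvent_claimSum t n (g := fun s => (X.c * t - s) ^ j)
    (by fun_prop), ← Real.norm_eq_abs]
  exact norm_integral_le_integral_norm _

/-- At least one claim by time `t` means exactly one or at least two, and the latter has probability
at most `(λ t)²`. -/
theorem measureReal_countEvent_one (X : RiskModel Ω P) {t : ℝ}
    (ht : 0 ≤ t) :
    1 - Real.exp (-(X.lam * t)) - (X.lam * t) ^ 2 ≤ P.real (X.countEvent t 1) ∧
    P.real (X.countEvent t 1) ≤ 1 - Real.exp (-(X.lam * t)) := by
  have hl := X.lam_pos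
  have h1 : 0 ≤ 1 - Real.exp (-(X.lam * t)) := by
    rw [sub_nonneg, Real.exp_le_one_iff]
    nlinarith
  have hr1 : P.real {ω | X.arrival 1 ω ≤ t} = 1 - Real.exp (-(X.lam * t)) := by
    have : {ω | X.arrival 1 ω ≤ t} = {ω | X.W 0 ω ≤ t} := by ext ω; simp [arrival]
    rw [this, measureReal_def, X.measure_W_le 0 ht, ENNReal.toReal_ofReal h1]
  have hr2 : P.real {ω | X.arrival 2 ω ≤ t} ≤ (X.lam * t) ^ 2 := by
    have h2 : P.real {ω | X.arrival 2 ω ≤ t} ≤ (1 - Real.exp (-(X.lam * t))) ^ 2 := by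
      refine ENNReal.toReal_le_of_le_ofReal (by positivity) ?_
      rw [ENNReal.ofReal_pow h1]
      exact X.measure_arrival_le 2 ht
    refine h2.trans (pow_le_pow_left₀ h1 ?_ 2)
    linarith [Real.add_one_le_exp (-(X.lam * t))]
  constructor
  · have : P.real {ω | X.arrival 1 ω ≤ t}
        ≤ P.real (X.countEvent t 1) + P.real {ω | X.arrival 2 ω ≤ t} := by
      refine (measureReal_mono fun ω hω => ?_).trans (measureReal_union_le _ _)
      rcases lt_or_ge t (X.arrival 2 ω) with h2 | h2
      · exact Or.inl ⟨hω, h2⟩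
      · exact Or.inr h2
    linarith
  · rw [← hr1]
    exact measureReal_mono fun ω hω => hω.1

theorem tendsto_one_sub_exp_div (l : ℝ) :
    Tendsto (fun t : ℝ => (1 - Real.exp (-(l * t))) / t) (𝓝[>] 0) (𝓝 l) := by
  have hd : HasDerivAt (fun t : ℝ => 1 - Real.exp (-(l * t))) l 0 := by
    convert! (((hasDerivAt_id (0 : ℝ)).const_mul l).neg.exp).const_sub 1 using 1
    simp
  have := hd.tendsto_slope_zero_right
  refine this.congr fun t => ?_
  simp [div_eq_inv_mul]

theorem tendsto_countEvent_one_div (X : RiskModel Ω P) :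
    Tendsto (fun t => P.real (X.countEvent t 1) / t) (𝓝[>] 0) (𝓝 X.lam) := by
  have h1 := tendsto_one_sub_exp_div X.lam
  have h2 : Tendsto (fun t : ℝ => X.lam ^ 2 * t) (𝓝[>] 0) (𝓝 0) := by
    have : Continuous fun t : ℝ => X.lam ^ 2 * t := by fun_prop
    simpa using (this.tendsto 0).mono_left nhdsWithin_le_nhds
  have h3 := h1.sub h2
  rw [sub_zero] at h3
  refine tendsto_of_tendsto_of_tendsto_of_le_of_le' h3 h1 ?_ ?_
  · filter_upwards [self_mem_nhdsWithin] with t (ht : 0 < t)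
    rw [le_div_iff₀ ht]
    refine le_trans (le_of_eq ?_) (X.measureReal_countEvent_one ht.le).1
    field_simp
  · filter_upwards [self_mem_nhdsWithin] with t (ht : 0 < t)
    exact div_le_div_of_nonneg_right (X.measureReal_countEvent_one ht.le).2 ht.le

theorem IsAdjustmentCoeff.tendsto_integral_pow_sub (h : X.IsAdjustmentCoeff R) (j : ℕ) :
    Tendsto (fun t => ∫ ω, (X.c * t - X.claimSum 1 ω) ^ j ∂P) (𝓝[>] 0)
      (𝓝 ((-1) ^ j * X.moment j)) := by
  have hm := X.measurable_claimSum 1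
  have he : (-1) ^ j * X.moment j = ∫ ω, (-X.claimSum 1 ω) ^ j ∂P := by
    rw [moment, ← integral_const_mul]
    refine integral_congr_ae (ae_of_all _ fun ω => ?_)
    simp only [claimSum, Finset.sum_range_one]
    exact (neg_pow (X.Z 0 ω) j).symm
  rw [he]
  refine tendsto_integral_filter_of_dominated_convergence
    (fun ω => j.factorial / R ^ j * Real.exp (R * X.c) * Real.exp (R * X.claimSum 1 ω))
    (Eventually.of_forall fun t => by fun_prop) ?_
    ((h.integrable_exp_claimSum 1).const_mul _) (ae_of_all _ fun ω => ?_)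
  · filter_upwards [Ioc_mem_nhdsGT (zero_lt_one' ℝ)] with t ht
    filter_upwards [X.ae_Z_pos] with ω hω
    exact pow_abs_sub_le h.1 X.c_pos ht.1.le ht.2 (Finset.sum_nonneg fun i _ => (hω i).le) j
  · have : Continuous fun t : ℝ => (X.c * t - X.claimSum 1 ω) ^ j := by fun_prop
    have := (this.tendsto 0).mono_left (nhdsWithin_le_nhds (s := Ioi 0))
    simpa using this

/-- The right derivative at `0` of the moments of the reserve. -/
theorem IsAdjustmentCoeff.tendsto_moment_reserve_div (h : X.IsAdjustmentCoeff R) {j : ℕ}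
    (hj : 1 ≤ j) :
    Tendsto (fun t => (∫ ω, X.reserve 0 t ω ^ j ∂P) / t) (𝓝[>] 0)
      (𝓝 ((if j = 1 then X.c else 0) + X.lam * ((-1) ^ j * X.moment j))) := by
  have hl := X.lam_pos
  have hR := h.1
  set M := mgf (X.Z 0) P R with hMdef
  have hM : 0 < M := mgf_pos h.integrable_exp_Z
  set A := j.factorial / R ^ j * Real.exp (R * X.c) with hA
  have hApos : 0 < A := by positivity
  -- Without a claim the moment is `e^{-λt} (c t)^j`, of order `t` only for `j = 1`. One claim
  -- contributes `λ t (-1)^j m_j` to first order, and two or more claims `O(t²)`, as the tail of a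
  -- geometric series.
  have t0 : Tendsto (fun t => X.momentPart j t 0 / t) (𝓝[>] 0) (𝓝 (if j = 1 then X.c else 0)) := by
    have hc : Continuous fun t : ℝ => Real.exp (-(X.lam * t)) * (X.c ^ j * t ^ (j - 1)) := by
      fun_prop
    have := (hc.tendsto 0).mono_left (nhdsWithin_le_nhds (s := Ioi 0))
    have hv : Real.exp (-(X.lam * 0)) * (X.c ^ j * 0 ^ (j - 1)) = if j = 1 then X.c else 0 := by
      rcases eq_or_ne j 1 with rfl | hj1
      · simp
      · have : j - 1 ≠ 0 := by omega
        simp [this, hj1]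
    rw [hv] at this
    refine this.congr' ?_
    filter_upwards [self_mem_nhdsWithin] with t (ht : 0 < t)
    have hjt : t ^ j = t ^ (j - 1) * t := by rw [← pow_succ, Nat.sub_add_cancel hj]
    rw [momentPart, X.measureReal_countEvent_zero ht.le]
    simp only [claimSum, Finset.range_zero, Finset.sum_empty, sub_zero, integral_const,
      probReal_univ, smul_eq_mul, one_mul]
    rw [mul_pow, hjt]
    field_simp
  have t1 : Tendsto (fun t => X.momentPart j t 1 / t) (𝓝[>] 0)
      (𝓝 (X.lam * ((-1) ^ j * X.moment j))) := by
    refine (X.tendsto_countEvent_one_div.mul (h.tendsto_integral_pow_sub j)).congr fun t => ?_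
    rw [momentPart]
    ring
  have hev : ∀ᶠ t in 𝓝[>] (0 : ℝ), 0 < t ∧ t ≤ 1 ∧ X.lam * t * M ≤ 1 / 2 := by
    have hpos : 0 < min 1 (1 / (2 * (X.lam * M))) := by positivity
    filter_upwards [Ioc_mem_nhdsGT hpos] with t ht
    refine ⟨ht.1, ht.2.trans (min_le_left _ _), ?_⟩
    have h2 : t ≤ 1 / (2 * (X.lam * M)) := ht.2.trans (min_le_right _ _)
    rw [le_div_iff₀ (by positivity)] at h2
    linarith
  have t2 : Tendsto (fun t => (∫ ω, X.reserve 0 t ω ^ j ∂P) / t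
      - (X.momentPart j t 0 / t + X.momentPart j t 1 / t)) (𝓝[>] 0) (𝓝 0) := by
    have hb : Tendsto (fun t : ℝ => 2 * A * (X.lam * M) ^ 2 * t) (𝓝[>] 0) (𝓝 0) := by
      have : Continuous fun t : ℝ => 2 * A * (X.lam * M) ^ 2 * t := by fun_prop
      simpa using (this.tendsto 0).mono_left (nhdsWithin_le_nhds (s := Ioi 0))
    refine squeeze_zero_norm' ?_ hb
    filter_upwards [hev] with t ⟨ht, ht1, hts⟩
    have hs := h.hasSum_momentPart j ht.le ht1 (by linarith)
    have hs2 := (hasSum_nat_add_iff' 2).2 hs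
    have hgeo : HasSum (fun n => A * (X.lam * t * M) ^ (n + 2))
        (A * (X.lam * t * M) ^ 2 * (1 - X.lam * t * M)⁻¹) := by
      have := (hasSum_geometric_of_lt_one (r := X.lam * t * M) (by positivity)
        (by linarith)).mul_left (A * (X.lam * t * M) ^ 2)
      refine this.congr_fun ?_ |> fun h => h
      intro n
      ring
    have hle := hs2.norm_le_of_bounded hgeo fun n => h.abs_momentPart_le j ht.le ht1 (n + 2)
    simp only [Finset.sum_range_succ, Finset.range_zero, Finset.sum_empty, zero_add] at hle
    rw [← add_div, ← sub_div, norm_div, Real.norm_of_nonneg ht.le, div_le_iff₀ ht]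
    refine hle.trans ?_
    have hinv : (1 - X.lam * t * M)⁻¹ ≤ 2 := by
      rw [inv_le_comm₀ (by linarith) two_pos]
      linarith
    calc _ ≤ A * (X.lam * t * M) ^ 2 * 2 := by gcongr
      _ = _ := by ring
  have := t2.add (t0.add t1)
  rw [zero_add] at this
  exact this.congr fun t => by ring

end Moments

/-- Models whose reserves have the same first `k` moments have the same drift and the same
second to `k`-th cumulants per unit time. -/
theorem IsDeVylder.cumulants {Ω' : Type*} [MeasurableSpace Ω'] {P' : Measure Ω'}
    [IsProbabilityMeasure P] [IsProbabilityMeasure P'] {X : RiskModel Ω P} {Y : RiskModel Ω' P'}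
    {k : ℕ} {R R' : ℝ} (hXY : X.IsDeVylder Y k) (hX : X.IsAdjustmentCoeff R)
    (hY : Y.IsAdjustmentCoeff R') {j : ℕ} (hj : 1 ≤ j) (hjk : j ≤ k) :
    (if j = 1 then X.c else 0) + X.lam * ((-1) ^ j * X.moment j)
      = (if j = 1 then Y.c else 0) + Y.lam * ((-1) ^ j * Y.moment j) := by
  refine tendsto_nhds_unique (hX.tendsto_moment_reserve_div hj) ?_
  refine (hY.tendsto_moment_reserve_div hj).congr' ?_
  filter_upwards [self_mem_nhdsWithin] with t (ht : 0 < t)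
  rw [hXY j hj hjk t 0 ht.le le_rfl]

end RiskModel

/-! ### Comparison of the adjustment coefficients. -/

/-- A polynomial without constant term and with nonnegative coefficients grows at least as fast as
its linear part. -/
theorem mul_sub_le_sum_pow_sub {n : ℕ} {b : ℕ → ℝ} (hb : ∀ i ∈ Finset.range (n + 1), 0 ≤ b i)
    {x y : ℝ} (hx : 0 ≤ x) (hxy : x ≤ y) :
    b 0 * (y - x) ≤ ∑ i ∈ Finset.range (n + 1), b i * y ^ (i + 1)
      - ∑ i ∈ Finset.range (n + 1), b i * x ^ (i + 1) := by
  rw [← Finset.sum_sub_distrib]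
  have h := Finset.single_le_sum (f := fun i => b i * y ^ (i + 1) - b i * x ^ (i + 1))
    (fun i hi => by
      have := pow_le_pow_left₀ hx hxy (i + 1)
      have := mul_le_mul_of_nonneg_left this (hb i hi)
      linarith) (Finset.mem_range.2 (Nat.succ_pos n))
  refine le_trans (le_of_eq ?_) h
  simp only [zero_add, pow_one]
  ring

theorem abs_exp_neg_sub_exp_neg_le (x y : ℝ) {z : ℝ} (hx : z ≤ x) (hy : z ≤ y) :
    |Real.exp (-x) - Real.exp (-y)| ≤ Real.exp (-z) * |x - y| := by
  wlog hxy : x ≤ y generalizing x y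
  · rw [abs_sub_comm, abs_sub_comm x]
    exact this y x hy hx (le_of_not_ge hxy)
  have h1 : Real.exp (-y) ≤ Real.exp (-x) := Real.exp_le_exp.2 (by linarith)
  have h2 : Real.exp (-y) = Real.exp (-x) * Real.exp (x - y) := by rw [← Real.exp_add]; congr 1; ring
  have h3 := Real.add_one_le_exp (x - y)
  have h4 : Real.exp (-x) ≤ Real.exp (-z) := Real.exp_le_exp.2 (by linarith)
  rw [abs_of_nonneg (by linarith), abs_of_nonpos (by linarith)]
  calc Real.exp (-x) - Real.exp (-y) = Real.exp (-x) * (1 - Real.exp (x - y)) := by rw [h2]; ring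
    _ ≤ Real.exp (-x) * (-(x - y)) := by gcongr; linarith
    _ ≤ _ := by gcongr; linarith

namespace RiskModel

variable {Ω Ω' : Type*} [MeasurableSpace Ω] [MeasurableSpace Ω'] {P : Measure Ω} {P' : Measure Ω'}

theorem lam_mul_moment_one_mul_theta {X : RiskModel Ω P} (hm : 0 < X.moment 1) :
    X.lam * X.moment 1 * X.theta = X.c - X.lam * X.moment 1 := by
  have := X.lam_pos
  rw [theta]
  field_simp

variable [IsProbabilityMeasure P] [IsProbabilityMeasure P']

theorem Assumptions.moment_pos {X : RiskModel Ω P} {k : ℕ} {R : ℝ} (h : X.Assumptions k R)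
    (j : ℕ) : 0 < X.moment j :=
  RiskModel.moment_pos X (h.1.integrable_pow_Z j)

/-- The adjustment coefficient agrees to second order with `2 (c - λ m₁) / (λ m₂)`. -/
theorem Assumptions.adjustment_first_order {X : RiskModel Ω P} {k : ℕ} {R K : ℝ}
    (h : X.Assumptions k R) (hk : 2 ≤ k) (hK : X.expMoment k R ≤ K) {δ : ℝ}
    (hδ : X.lam * X.moment 2 * δ = 2 * (X.c - X.lam * X.moment 1)) :
    R ≤ δ ∧ δ - R ≤ (δ + 2 * X.moment 1 / X.moment 2) * (1 + K) * δ ^ 2 := by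
  have hl := X.lam_pos
  have hR := h.1.1
  have hm1 := h.moment_pos 1
  have hm2 := h.moment_pos 2
  have hK0 : 0 ≤ K := (h.tiltedRenewal hk hK le_rfl).bound_nonneg
  obtain ⟨h1, h2⟩ := h.lundberg_expansion hk hK hk
  simp only [Finset.sum_range_succ, Finset.range_zero, Finset.sum_empty, zero_add, pow_zero,
    Nat.factorial, pow_one, Nat.reduceAdd] at h1 h2
  norm_num at h1 h2
  have hlm : 0 < X.lam * X.moment 2 := by positivity
  have hRδ : R ≤ δ := by
    refine le_of_mul_le_mul_left ?_ hlm
    linarith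
  refine ⟨hRδ, ?_⟩
  -- Expresses `c` through `λ`, `δ` and the fixed moments, so that `λ` cancels and the bound does
  -- not depend on it.
  have hc : X.c = X.lam * X.moment 2 / 2 * (δ + 2 * X.moment 1 / X.moment 2) := by
    field_simp
    linarith
  have hpos : 0 ≤ δ + 2 * X.moment 1 / X.moment 2 := by
    have := hR.le.trans hRδ
    positivity
  refine le_of_mul_le_mul_left (a := X.lam * X.moment 2 / 2) ?_ (by positivity)
  calc X.lam * X.moment 2 / 2 * (δ - R) ≤ X.c * (R ^ 2 * (1 + K)) := by linarith
    _ ≤ X.c * (δ ^ 2 * (1 + K)) := by have := X.c_pos; gcongr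
    _ = X.lam * X.moment 2 / 2 * ((δ + 2 * X.moment 1 / X.moment 2) * (1 + K) * δ ^ 2) := by
      nth_rw 1 [hc]; ring

/-- The partial sum of the Cramér-Lundberg equation without its constant term. -/
theorem Assumptions.lundberg_expansion_drift {X : RiskModel Ω P} {n : ℕ} {R K : ℝ}
    (h : X.Assumptions (n + 2) R) (hK : X.expMoment (n + 2) R ≤ K) :
    0 ≤ X.c - X.lam * X.moment 1 - ∑ i ∈ Finset.range (n + 1),
      X.lam * X.moment (i + 2) / (i + 2).factorial * R ^ (i + 1) ∧
    X.c - X.lam * X.moment 1 - ∑ i ∈ Finset.range (n + 1),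
      X.lam * X.moment (i + 2) / (i + 2).factorial * R ^ (i + 1) ≤ X.c * (R ^ (n + 2) * (1 + K)) := by
  have := h.lundberg_expansion (by omega) hK le_rfl
  rw [Finset.sum_range_succ'] at this
  simp only [zero_add, Nat.factorial_one, Nat.cast_one, div_one, pow_zero, mul_one] at this
  constructor <;> linarith

variable {X : RiskModel Ω P} {Y : RiskModel Ω' P'} {k : ℕ} {R R' : ℝ}

theorem IsDeVylder.drift_eq (hXY : X.IsDeVylder Y k) (hk : 1 ≤ k) (hX : X.Assumptions k R)
    (hY : Y.Assumptions k R') :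
    X.c - X.lam * X.moment 1 = Y.c - Y.lam * Y.moment 1 := by
  have := hXY.cumulants hX.1 hY.1 le_rfl hk
  simp only [if_true] at this
  linarith

theorem IsDeVylder.lam_mul_moment_eq (hXY : X.IsDeVylder Y k) (hX : X.Assumptions k R)
    (hY : Y.Assumptions k R') {j : ℕ} (hj : 2 ≤ j) (hjk : j ≤ k) :
    X.lam * X.moment j = Y.lam * Y.moment j := by
  have h := hXY.cumulants hX.1 hY.1 (by omega) hjk
  rw [if_neg (by omega), if_neg (by omega), zero_add, zero_add, mul_left_comm,
    mul_left_comm Y.lam] at h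
  exact mul_left_cancel₀ (pow_ne_zero _ (by norm_num)) h

/-- The adjustment coefficients of two models with matching moments are close. -/
theorem IsDeVylder.abs_adjustment_sub_le (hXY : X.IsDeVylder Y k) (hk : 2 ≤ k)
    (hX : X.Assumptions k R) (hY : Y.Assumptions k R') {K : ℝ} (hKX : X.expMoment k R ≤ K)
    (hKY : Y.expMoment k R' ≤ K) {δ : ℝ}
    (hδ : X.lam * X.moment 2 * δ = 2 * (X.c - X.lam * X.moment 1)) :
    |R - R'| ≤ (δ + 2 * X.moment 1 / X.moment 2 + 2 * Y.moment 1 / Y.moment 2) * (1 + K)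
      * δ ^ k := by
  have hl := X.lam_pos
  have hl' := Y.lam_pos
  have hm1 := hX.moment_pos 1
  have hm2 := hX.moment_pos 2
  have hm1' := hY.moment_pos 1
  have hm2' := hY.moment_pos 2
  have hdrift := hXY.drift_eq (by omega) hX hY
  have h2 := hXY.lam_mul_moment_eq hX hY le_rfl hk
  have hδ' : Y.lam * Y.moment 2 * δ = 2 * (Y.c - Y.lam * Y.moment 1) := by
    rw [← h2, ← hdrift, hδ]
  have hRδ := (hX.adjustment_first_order hk hKX hδ).1
  have hRδ' := (hY.adjustment_first_order hk hKY hδ').1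
  have hδ0 : 0 < δ := hX.1.1.trans_le hRδ
  have hR := hX.1.1
  have hR' := hY.1.1
  have hK0 : 0 ≤ K := (hX.tiltedRenewal hk hKX le_rfl).bound_nonneg
  obtain ⟨n, rfl⟩ := Nat.exists_eq_add_of_le' hk
  -- By moment matching these coefficients, and the drift, are common to both models. With `k = n +
  -- 2` the polynomial stops at degree `k - 1`; its values at `R` and `R'` both lie below the drift
  -- by at most an error of order `δ^k`, and its slope is at least `b 0`.
  set b : ℕ → ℝ := fun i => X.lam * X.moment (i + 2) / (i + 2).factorial with hb
  have hbY : ∀ i ∈ Finset.range (n + 1),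
      Y.lam * Y.moment (i + 2) / (i + 2).factorial * R' ^ (i + 1) = b i * R' ^ (i + 1) := by
    intro i hi
    have := Finset.mem_range.1 hi
    rw [hb]
    simp only
    rw [hXY.lam_mul_moment_eq hX hY (by omega) (by omega)]
  obtain ⟨eX0, eX1⟩ := hX.lundberg_expansion_drift hKX
  obtain ⟨eY0, eY1⟩ := hY.lundberg_expansion_drift hKY
  rw [Finset.sum_congr rfl hbY, ← hdrift] at eY0 eY1
  have hb0 : ∀ i ∈ Finset.range (n + 1), 0 ≤ b i := fun i _ => by
    have := hX.moment_pos (i + 2)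
    positivity
  set B := δ + 2 * X.moment 1 / X.moment 2 + 2 * Y.moment 1 / Y.moment 2 with hB
  have hb00 : b 0 = X.lam * X.moment 2 / 2 := by simp [hb]
  have hcX : X.c ≤ b 0 * B := by
    have e : X.c = b 0 * (δ + 2 * X.moment 1 / X.moment 2) := by
      rw [hb00]; field_simp; linarith
    rw [e, hB]
    have : 0 ≤ 2 * Y.moment 1 / Y.moment 2 := by positivity
    exact mul_le_mul_of_nonneg_left (by linarith) (hb0 0 (by simp))
  have hcY : Y.c ≤ b 0 * B := by
    have e : Y.c = b 0 * (δ + 2 * Y.moment 1 / Y.moment 2) := by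
      rw [hb00, h2]; field_simp; linarith
    rw [e, hB]
    have : 0 ≤ 2 * X.moment 1 / X.moment 2 := by positivity
    exact mul_le_mul_of_nonneg_left (by linarith) (hb0 0 (by simp))
  have hB0 : 0 ≤ B := by positivity
  have hb0pos : 0 < b 0 := by rw [hb00]; positivity
  have bX : X.c * (R ^ (n + 2) * (1 + K)) ≤ b 0 * (B * (1 + K) * δ ^ (n + 2)) := by
    calc _ ≤ b 0 * B * (δ ^ (n + 2) * (1 + K)) := by gcongr
      _ = _ := by ring
  have bY : Y.c * (R' ^ (n + 2) * (1 + K)) ≤ b 0 * (B * (1 + K) * δ ^ (n + 2)) := by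
    calc _ ≤ b 0 * B * (δ ^ (n + 2) * (1 + K)) := by gcongr
      _ = _ := by ring
  refine le_of_mul_le_mul_left (a := b 0) ?_ hb0pos
  rcases le_total R R' with hRR | hRR
  · have := mul_sub_le_sum_pow_sub hb0 hR.le hRR
    rw [abs_of_nonpos (by linarith)]
    linarith
  · have := mul_sub_le_sum_pow_sub hb0 hR'.le hRR
    rw [abs_of_nonneg (by linarith)]
    linarith

end RiskModel

/-! ### Comparison of the ruin probabilities and the theorem. -/

/-- Comparison of two solutions of tilted renewal equations. -/
theorem TiltedRenewal.abs_sub_le {ψ ρ ψ' ρ' : ℝ → ℝ} {k : ℕ} {R R' K H : ℝ}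
    (h : TiltedRenewal ψ ρ k R K H) (h' : TiltedRenewal ψ' ρ' k R' K H) {δ : ℝ} (hR : R ≤ δ)
    (hR' : R' ≤ δ) {u : ℝ} (hu : 0 ≤ u) :
    |ψ u - ψ' u| ≤ (δ * ((1 + K) * (1 + H)) + |R - R'| * u) * Real.exp (-(min R R' * u)) := by
  have hK := h.bound_nonneg
  have hH := h.hazard_nonneg
  set L := δ * ((1 + K) * (1 + H)) with hL
  -- Each solution equals its pure exponential up to a relative error `L`; what is left is the
  -- difference of the two exponentials.
  have key : ∀ {ψ ρ : ℝ → ℝ} {R : ℝ}, TiltedRenewal ψ ρ k R K H → R ≤ δ →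
      Real.exp (-(R * u)) - Real.exp (-(R * u)) * L ≤ ψ u ∧ ψ u ≤ Real.exp (-(R * u)) := by
    intro ψ ρ R h hR
    have h1 := h.tilted_le_one u hu
    have h2 := (h.one_sub_tilted_le u hu).trans (mul_le_mul_of_nonneg_right hR (by positivity))
    have h3 : ψ u = Real.exp (-(R * u)) * (Real.exp (R * u) * ψ u) := by
      rw [← mul_assoc, ← Real.exp_add]; simp
    rw [h3]
    have h4 := Real.exp_pos (-(R * u))
    constructor
    · rw [← mul_one_sub]
      exact mul_le_mul_of_nonneg_left (by linarith) h4.le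
    · exact mul_le_of_le_one_right h4.le h1
  have hm : min R R' * u ≤ R * u := mul_le_mul_of_nonneg_right (min_le_left _ _) hu
  have hm' : min R R' * u ≤ R' * u := mul_le_mul_of_nonneg_right (min_le_right _ _) hu
  obtain ⟨a1, a2⟩ := key h hR
  obtain ⟨b1, b2⟩ := key h' hR'
  have hd := abs_exp_neg_sub_exp_neg_le _ _ hm hm'
  rw [← sub_mul, abs_mul, abs_of_nonneg hu] at hd
  have hL0 : 0 ≤ L := by
    have := h.pos.le.trans hR
    positivity
  have c1 : Real.exp (-(R * u)) * L ≤ Real.exp (-(min R R' * u)) * L := by gcongr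
  have c2 : Real.exp (-(R' * u)) * L ≤ Real.exp (-(min R R' * u)) * L := by gcongr
  obtain ⟨d1, d2⟩ := abs_le.1 hd
  rw [abs_le]
  constructor <;> linarith

theorem theorem1 (k : ℕ) (hk : 2 ≤ k) (m mDV : ℕ → ℝ) (K H Θ : ℝ) :
    ∃ C : ℝ, 0 ≤ C ∧
      ∀ {Ω Ω' : Type*} [MeasurableSpace Ω] [MeasurableSpace Ω']
        (P : Measure Ω) (P' : Measure Ω') [IsProbabilityMeasure P] [IsProbabilityMeasure P']
        (X : RiskModel Ω P) (Y : RiskModel Ω' P') (R RDV : ℝ),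
        X.Assumptions k R → Y.Assumptions k RDV →
        X.IsDeVylder Y k →
        0 < X.theta → X.theta ≤ Θ →
        (∀ j : ℕ, 1 ≤ j → j ≤ k → X.moment j = m j ∧ Y.moment j = mDV j) →
        X.expMoment k R ≤ K → Y.expMoment k RDV ≤ K →
        X.hI ≤ H → Y.hI ≤ H →
        -- absolute error
        (∀ u : ℝ, 0 ≤ u →
          |X.ruinProb u - Y.ruinProb u|
            ≤ C * (X.theta + X.theta ^ k * u) * Real.exp (-(min R RDV * u))) ∧
        -- absolute error, with the first order expansion of the exponent
        (∃ r : ℝ, |r| ≤ C * X.theta ^ 2 ∧ ∀ u : ℝ, 0 ≤ u →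
          |X.ruinProb u - Y.ruinProb u|
            ≤ C * (X.theta + X.theta ^ k * u)
              * Real.exp (-(|2 * X.moment 1 / X.moment 2 * X.theta + r| * u))) ∧
        -- relative error
        (∀ u : ℝ, 0 ≤ u →
          0 < X.ruinProb u ∧
          |(X.ruinProb u - Y.ruinProb u) / X.ruinProb u|
            ≤ C * (X.theta + X.theta ^ k * u)
              * Real.exp (C * (X.theta ^ k * u) * (if RDV < R then 1 else 0))) := by
  -- If the prescribed numbers violate these signs, no pair of models has them and any `C` will do.
  by_cases hpos : 0 < m 1 ∧ 0 < m 2 ∧ 0 < mDV 1 ∧ 0 < mDV 2 ∧ 0 ≤ K ∧ 0 ≤ H ∧ 0 < Θ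
  swap
  · refine ⟨0, le_rfl, ?_⟩
    intro Ω Ω' _ _ P P' _ _ X Y R RDV hX hY _ hθ hθΘ hm hKX _ hHX _
    refine absurd ?_ hpos
    rw [← (hm 1 le_rfl (by omega)).1, ← (hm 2 (by omega) hk).1, ← (hm 1 le_rfl (by omega)).2,
      ← (hm 2 (by omega) hk).2]
    exact ⟨hX.moment_pos 1, hX.moment_pos 2, hY.moment_pos 1, hY.moment_pos 2,
      (hX.tiltedRenewal hk hKX hHX).bound_nonneg, (hX.tiltedRenewal hk hKX hHX).hazard_nonneg,
      hθ.trans_le hθΘ⟩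
  obtain ⟨hm1, hm2, hm1', hm2', hK, hH, hΘ⟩ := hpos
  -- With `δ = α θ`: `L θ` bounds the deviation from the pure exponentials, `M θ^k` bounds `|R -
  -- RDV|`, `N θ²` bounds `δ - R` and `δ - RDV`, and `b` bounds `e^{Ru} ψ(u)` from below. Here `B`
  -- absorbs the factor in front of `1 + K`, using `δ ≤ α Θ`.
  set α := 2 * m 1 / m 2 with hα
  set B := α * Θ + α + 2 * mDV 1 / mDV 2 with hB
  set L := α * ((1 + K) * (1 + H)) with hL
  set M := B * (1 + K) * α ^ k with hM
  set N := B * (1 + K) * α ^ 2 with hN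
  set b := Real.exp (-(α * Θ * (2 * ((1 + K) * (1 + H))))) / 2 with hb
  have hα0 : 0 < α := by positivity
  have hB0 : 0 < B := by positivity
  have hL0 : 0 < L := by positivity
  have hM0 : 0 < M := by positivity
  have hN0 : 0 < N := by positivity
  have hb0 : 0 < b := by positivity
  refine ⟨L + M + N + (L + M) / b, by positivity, ?_⟩
  intro Ω Ω' _ _ P P' _ _ X Y R RDV hX hY hXY hθ hθΘ hm hKX hKY hHX hHY
  set C := L + M + N + (L + M) / b with hC
  set θ := X.theta with hθdef
  have hLMb : 0 < (L + M) / b := by positivity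
  have e1 : X.moment 1 = m 1 := (hm 1 le_rfl (by omega)).1
  have e2 : X.moment 2 = m 2 := (hm 2 (by omega) hk).1
  have e1' : Y.moment 1 = mDV 1 := (hm 1 le_rfl (by omega)).2
  have e2' : Y.moment 2 = mDV 2 := (hm 2 (by omega) hk).2
  set δ := α * θ with hδdef
  have hδ0 : 0 < δ := by positivity
  have hδ : X.lam * X.moment 2 * δ = 2 * (X.c - X.lam * X.moment 1) := by
    rw [← RiskModel.lam_mul_moment_one_mul_theta (hX.moment_pos 1), hδdef, hα, e1, e2]
    field_simp
    rfl
  have hδ' : Y.lam * Y.moment 2 * δ = 2 * (Y.c - Y.lam * Y.moment 1) := by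
    rw [← hXY.lam_mul_moment_eq hX hY le_rfl hk, ← hXY.drift_eq (by omega) hX hY, hδ]
  obtain ⟨hRδ, hRδ2⟩ := hX.adjustment_first_order hk hKX hδ
  obtain ⟨hRδ', hRδ2'⟩ := hY.adjustment_first_order hk hKY hδ'
  have hRR := hXY.abs_adjustment_sub_le hk hX hY hKX hKY hδ
  have tX := hX.tiltedRenewal hk hKX hHX
  have tY := hY.tiltedRenewal hk hKY hHY
  rw [e1, e2, ← hα] at hRδ2
  rw [e1', e2'] at hRδ2'
  rw [e1, e2, e1', e2', ← hα] at hRR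
  have hδΘ : δ ≤ α * Θ := by rw [hδdef]; gcongr
  have hα' : 0 < 2 * mDV 1 / mDV 2 := by positivity
  have hRR : |R - RDV| ≤ M * θ ^ k := by
    calc |R - RDV| ≤ _ := hRR
      _ ≤ B * (1 + K) * δ ^ k := by gcongr; linarith
      _ = _ := by rw [hδdef, mul_pow]; ring
  have hN1 : δ - R ≤ N * θ ^ 2 := by
    calc _ ≤ _ := hRδ2
      _ ≤ B * (1 + K) * δ ^ 2 := by gcongr; linarith
      _ = _ := by rw [hδdef, mul_pow]; ring
  have hN2 : δ - RDV ≤ N * θ ^ 2 := by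
    calc _ ≤ _ := hRδ2'
      _ ≤ B * (1 + K) * δ ^ 2 := by gcongr; linarith
      _ = _ := by rw [hδdef, mul_pow]; ring
  have habs : ∀ u : ℝ, 0 ≤ u → |X.ruinProb u - Y.ruinProb u|
      ≤ (L + M) * (θ + θ ^ k * u) * Real.exp (-(min R RDV * u)) := by
    intro u hu
    refine (tX.abs_sub_le tY hRδ hRδ' hu).trans ?_
    have hk0 : 0 ≤ θ ^ k * u := by positivity
    have hru : |R - RDV| * u ≤ M * (θ ^ k * u) := by
      rw [← mul_assoc]; gcongr
    have h1 : δ * ((1 + K) * (1 + H)) = L * θ := by rw [hδdef, hL]; ring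
    refine mul_le_mul_of_nonneg_right ?_ (Real.exp_pos _).le
    rw [h1]
    have h2 := mul_nonneg hL0.le hk0
    have h3 := mul_nonneg hM0.le hθ.le
    calc L * θ + |R - RDV| * u ≤ L * θ + M * (θ ^ k * u) := by gcongr
      _ ≤ L * θ + M * (θ ^ k * u) + (L * (θ ^ k * u) + M * θ) :=
        le_add_of_nonneg_right (add_nonneg h2 h3)
      _ = _ := by ring
  have habsC : ∀ u : ℝ, 0 ≤ u → |X.ruinProb u - Y.ruinProb u|
      ≤ C * (θ + θ ^ k * u) * Real.exp (-(min R RDV * u)) := by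
    intro u hu
    refine (habs u hu).trans ?_
    have : L + M ≤ C := by rw [hC]; linarith
    gcongr
  -- With this `r` the exponent of the second claim is exactly `min R RDV`, so that claim reduces to
  -- the first.
  refine ⟨habsC, ⟨min R RDV - δ, ?_, ?_⟩, ?_⟩
  · have : min R RDV ≤ δ := (min_le_left _ _).trans hRδ
    rw [abs_of_nonpos (by linarith)]
    have hNC : N * θ ^ 2 ≤ C * θ ^ 2 := by
      have : N ≤ C := by rw [hC]; linarith
      gcongr
    rcases min_choice R RDV with h | h <;> rw [h] <;> linarith
  · intro u hu
    rw [e1, e2, ← hα, ← hδdef, add_sub_cancel, abs_of_pos (lt_min hX.1.1 hY.1.1)]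
    exact habsC u hu
  · intro u hu
    have hlow : b * Real.exp (-(R * u)) ≤ X.ruinProb u := by
      have h1 := tX.le_tilted u hu
      have h2 : b ≤ Real.exp (-(R * (2 * ((1 + K) * (1 + H))))) / 2 := by
        rw [hb]
        gcongr
        exact hRδ.trans hδΘ
      have h3 : X.ruinProb u = Real.exp (R * u) * X.ruinProb u * Real.exp (-(R * u)) := by
        rw [mul_right_comm, ← Real.exp_add]; simp
      rw [h3]
      gcongr
      exact h2.trans h1
    have hψ : 0 < X.ruinProb u := lt_of_lt_of_le (by positivity) hlow
    refine ⟨hψ, ?_⟩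
    rw [abs_div, abs_of_pos hψ, div_le_iff₀ hψ]
    -- Division by `ψ(u) ≥ b e^{-Ru}` costs nothing when `R` is the smaller coefficient; otherwise
    -- the loss `e^{(R - RDV) u}` is at most `e^{M θ^k u}`.
    have hexp : Real.exp (-(min R RDV * u)) ≤ Real.exp (-(R * u))
        * Real.exp (C * (θ ^ k * u) * (if RDV < R then 1 else 0)) := by
      rw [← Real.exp_add]
      apply Real.exp_le_exp.2
      split_ifs with hlt
      · rw [min_eq_right hlt.le]
        have h1 : (R - RDV) * u ≤ C * (θ ^ k * u) := by
          rw [← mul_assoc]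
          refine mul_le_mul_of_nonneg_right ?_ hu
          have h2 : M * θ ^ k ≤ C * θ ^ k := by
            have : M ≤ C := by rw [hC]; linarith
            gcongr
          exact (le_abs_self _).trans (hRR.trans h2)
        linarith
      · rw [min_eq_left (not_lt.1 hlt)]
        simp
    set W := Real.exp (C * (θ ^ k * u) * (if RDV < R then 1 else 0)) with hW
    calc |X.ruinProb u - Y.ruinProb u|
        ≤ (L + M) * (θ + θ ^ k * u) * (Real.exp (-(R * u)) * W) := by
          refine (habs u hu).trans ?_
          gcongr
      _ = (L + M) / b * (θ + θ ^ k * u) * W * (b * Real.exp (-(R * u))) := by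
          field_simp
      _ ≤ C * (θ + θ ^ k * u) * W * X.ruinProb u := by
          have : (L + M) / b ≤ C := by rw [hC]; linarith
          gcongr
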